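/- Let $p\in\mathbb N=\{1,2,\dots\}$, let $X=\mathbb C^p$ with the Euclidean norm, let $E=\ell^2(\mathbb Z,X)$, and let $A\in L(E)$ be a bounded linear operator with matrix representation $[a_{i,j}]_{i,j\in\mathbb Z}$, $a_{i,j}\in L(X)$. Suppose that $A$ is tridiagonal ($a_{i,j}=0$ for $|i-j|>1$) and block-Laurent (each diagonal is constant, i.e. $a_{j+d,j}$ does not depend on $j$, for every $d\in\mathbb Z$). Write $\alpha_j=a_{j+1,j}$, $\gamma_j=a_{j-1,j}$, $\|\alpha\|_\infty=\sup_j\|\alpha_j\|$, $\|\gamma\|_\infty=\sup_j\|\gamma_j\|$, $\mathbb T=\{t\in\mathbb C:|t|=1\}$. Notation. For a bounded operator $B$ on a complex normed space put $\|B^{-1}\|:=\infty$ if $B$ is not invertible, and $1/\infty:=0$. Let $\mathrm{Spec}\,B$ be the spectrum, $\mathrm{Spec}_0B:=\mathrm{Spec}\,B$, and for $\varepsilon>0$ $$\mathrm{Spec}_\varepsilon B=\{\lambda\in\mathbb C: 1/\|(B-\lambda I)^{-1}\|\le\varepsilon\},\qquad \mathrm{spec}_\varepsilon B=\{\lambda\in\mathbb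 C: 1/\|(B-\lambda I)^{-1}\|<\varepsilon\}.$$ For $n\in\mathbb N$, $k\in\mathbb Z$, $t\in\mathbb T$, let $A^{\mathrm{per},t}_{n,k}$ be the $n\times n$ matrix with entries in $L(X)$ whose $(i,j)$ entry, $1\le i,j\le n$, is $$a_{k+i,k+j}+\delta_{i,1}\delta_{j,n}\,t\,\alpha_k+\delta_{i,n}\delta_{j,1}\,\bar t\,\gamma_{k+n+1},$$ acting on $X^n$ with the norm $(\sum_{i}\|x_i\|^2)^{1/2}$. Let $$\Pi^{n,t}_\varepsilon(A)=\overline{\bigcup_{k\in\mathbb Z}\mathrm{Spec}_\varepsilon A^{\mathrm{per},t}_{n,k}}\ \ (\varepsilon\ge0),\qquad \pi^{n,t}_\varepsilon(A)=\bigcup_{k\in\mathbb Z}\mathrm{spec}_\varepsilon A^{\mathrm{per},t}_{n,k}\ \ (\varepsilon>0),$$ and $\varepsilon'_n=2(\|\alpha\|_\infty+\|\gamma\|_\infty)\sin\frac{\pi}{2n}$. For non-empty bounded sets $S_n,S\subset\mathbb C$, $S_n\to S$ means that the Hausdorff distance of $S_n$ and $S$ tends to $0$ as $n\to\infty$; convergence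 below includes the assertion that the sets involved are non-empty and bounded. Then the following hold. 1. For all $n\in\mathbb N$ and $t\in\mathbb T$: $A^{\mathrm{per},t}_{n,k}=A^{\mathrm{per},t}_{n,0}$ for every $k\in\mathbb Z$; hence $\Pi^{n,t}_\varepsilon(A)=\mathrm{Spec}_\varepsilon A^{\mathrm{per},t}_{n,0}$ for $\varepsilon\ge0$ and $\pi^{n,t}_\varepsilon(A)=\mathrm{spec}_\varepsilon A^{\mathrm{per},t}_{n,0}$ for $\varepsilon>0$. 2. For every $t\in\mathbb T$ the $\pi$ method does not suffer from spectral pollution for $A$: there is a positive null sequence $(\eta_m)_{m\in\mathbb N}$ such that $\mathrm{spec}_\varepsilon A^{\mathrm{per},t}_{m,k}\subset\mathrm{spec}_{\varepsilon+\eta_m}A$ for all $\varepsilon>0$, $m\in\mathbb N$, $k\in\mathbb Z$. 3. For all $n\in\mathbb N$ and $\varepsilon>0$, $$\mathrm{Spec}\,A=\bigcup_{t\in\mathbb T}\mathrm{Spec}\,A^{\mathrm{per},t}_{n,0},\quad \mathrm{spec}_\varepsilon A=\bigcup_{t\in\mathbb T}\mathrm{spec}_\varepsilon A^{\mathrm{per},t}_{n,0},\quad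 \mathrm{Spec}_\varepsilon A=\bigcup_{t\in\mathbb T}\mathrm{Spec}_\varepsilon A^{\mathrm{per},t}_{n,0}.$$ 4. For every $t\in\mathbb T$, as $n\to\infty$, $$\Pi^{n,t}_{\varepsilon+\varepsilon'_n}(A)=\mathrm{Spec}_{\varepsilon+\varepsilon'_n}A^{\mathrm{per},t}_{n,0}\to\mathrm{Spec}_\varepsilon A\quad(\varepsilon\ge0),$$ in particular $\Pi^{n,t}_{\varepsilon'_n}(A)=\mathrm{Spec}_{\varepsilon'_n}A^{\mathrm{per},t}_{n,0}\to\mathrm{Spec}\,A$, and $$\pi^{n,t}_{\varepsilon+\varepsilon'_n}(A)=\mathrm{spec}_{\varepsilon+\varepsilon'_n}A^{\mathrm{per},t}_{n,0}\to\mathrm{spec}_\varepsilon A\quad(\varepsilon>0).$$ -/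

import Mathlib

open Filter Topology
open scoped ENNReal

noncomputable section

namespace PiMethod

section Pseudospectra

variable {Y : Type*} [NormedAddCommGroup Y] [NormedSpace ℂ Y]

open Classical in
/-- `‖B⁻¹‖ ∈ [0, ∞]`, with the convention that `‖B⁻¹‖ = ∞` if `B` is not invertible in `L(Y)`. -/
def invNorm (B : Y →L[ℂ] Y) : ℝ≥0∞ :=
  if IsUnit B then ENNReal.ofReal ‖Ring.inverse B‖ else ∞

/-- The closed `ε`-pseudospectrum `{λ : 1 / ‖(B - λ I)⁻¹‖ ≤ ε}`, with `1 / ∞ = 0`. For `ε = 0` it is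
the spectrum, see `Specn_zero`. -/
def Specn (ε : ℝ) (B : Y →L[ℂ] Y) : Set ℂ :=
  {l | (invNorm (B - l • ContinuousLinearMap.id ℂ Y))⁻¹ ≤ ENNReal.ofReal ε}

/-- The open `ε`-pseudospectrum `{λ : 1 / ‖(B - λ I)⁻¹‖ < ε}`, with `1 / ∞ = 0`. -/
def specn (ε : ℝ) (B : Y →L[ℂ] Y) : Set ℂ :=
  {l | (invNorm (B - l • ContinuousLinearMap.id ℂ Y))⁻¹ < ENNReal.ofReal ε}

theorem Specn_zero (B : Y →L[ℂ] Y) : Specn 0 B = spectrum ℂ B := by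
  classical
  ext l
  have h : IsUnit (B - l • ContinuousLinearMap.id ℂ Y) ↔
      IsUnit (algebraMap ℂ (Y →L[ℂ] Y) l - B) := by
    rw [← IsUnit.neg_iff, neg_sub, Algebra.algebraMap_eq_smul_one]
    rfl
  rw [spectrum.mem_iff, ← h]
  simp only [Specn, invNorm, Set.mem_ofPred_eq, ENNReal.ofReal_zero, nonpos_iff_eq_zero,
    ENNReal.inv_eq_zero]
  split_ifs with h1 <;> simp [h1]

end Pseudospectra

section Operators

variable {X : Type*} [NormedAddCommGroup X] [NormedSpace ℂ X]

/-- `E = ℓ²(ℤ, X)`. -/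
abbrev BiSeq (X : Type*) [NormedAddCommGroup X] : Type _ := lp (fun _ : ℤ => X) 2

/-- The `(i, j)` entry `a_{i,j} ∈ L(X)` of the matrix representation of `A ∈ L(E)`. -/
def entry (A : BiSeq X →L[ℂ] BiSeq X) (i j : ℤ) : X →L[ℂ] X :=
  (lp.evalCLM ℂ (fun _ : ℤ => X) 2 i).comp
    (A.comp (lp.singleContinuousLinearMap ℂ (fun _ : ℤ => X) 2 j))

theorem entry_apply (A : BiSeq X →L[ℂ] BiSeq X) (i j : ℤ) (x : X) :
    entry A i j x = A (lp.single 2 j x) i := rfl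

def IsTridiagonal (A : BiSeq X →L[ℂ] BiSeq X) : Prop :=
  ∀ i j : ℤ, 1 < |i - j| → entry A i j = 0

/-- Every diagonal of the matrix representation is constant. -/
def IsBlockLaurent (A : BiSeq X →L[ℂ] BiSeq X) : Prop :=
  ∀ d : ℤ, ∃ c : X →L[ℂ] X, ∀ j : ℤ, entry A (j + d) j = c

/-- The subdiagonal `α_j = a_{j+1,j}`. -/
def subdiag (A : BiSeq X →L[ℂ] BiSeq X) (j : ℤ) : X →L[ℂ] X := entry A (j + 1) j

/-- The superdiagonal `γ_j = a_{j-1,j}`. -/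
def superdiag (A : BiSeq X →L[ℂ] BiSeq X) (j : ℤ) : X →L[ℂ] X := entry A (j - 1) j

/-- The finite section `A_{n,k}`: rows and columns `k+1, …, k+n` of `A`. -/
def finSection (A : BiSeq X →L[ℂ] BiSeq X) (n : ℕ) (k : ℤ) :
    Matrix (Fin n) (Fin n) (X →L[ℂ] X) :=
  Matrix.of fun i j => entry A (k + 1 + (i : ℕ)) (k + 1 + (j : ℕ))

/-- The corner matrix `B_{n,k}^t`: `t α_k` in the first row and last column, plus
`conj(t) γ_{k+n+1}` in the last row and first column (these coincide for `n = 1`). -/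
def cornerMatrix (A : BiSeq X →L[ℂ] BiSeq X) (n : ℕ) (k : ℤ) (t : Circle) :
    Matrix (Fin n) (Fin n) (X →L[ℂ] X) :=
  Matrix.of fun i j =>
    (if (i : ℕ) = 0 ∧ (j : ℕ) + 1 = n then (t : ℂ) • subdiag A k else 0) +
    (if (i : ℕ) + 1 = n ∧ (j : ℕ) = 0 then
      (starRingEnd ℂ (t : ℂ)) • superdiag A (k + n + 1) else 0)

/-- The periodised finite section `A_{n,k}^{per,t} = A_{n,k} + B_{n,k}^t`. -/
def perSection (A : BiSeq X →L[ℂ] BiSeq X) (n : ℕ) (k : ℤ) (t : Circle) :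
    Matrix (Fin n) (Fin n) (X →L[ℂ] X) :=
  finSection A n k + cornerMatrix A n k t

/-- The operator on `Xⁿ`, with norm `(∑ ‖x_i‖²)^{1/2}`, given by multiplication by an `n × n` matrix
with entries in `L(X)`. -/
def matOp {n : ℕ} (M : Matrix (Fin n) (Fin n) (X →L[ℂ] X)) :
    PiLp 2 (fun _ : Fin n => X) →L[ℂ] PiLp 2 (fun _ : Fin n => X) :=
  ((PiLp.continuousLinearEquiv 2 ℂ (fun _ : Fin n => X)).symm :
      (Fin n → X) →L[ℂ] PiLp 2 (fun _ : Fin n => X)).comp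
    (ContinuousLinearMap.pi fun i =>
      ∑ j, (M i j).comp (PiLp.proj (𝕜 := ℂ) 2 (fun _ : Fin n => X) j))

theorem matOp_apply {n : ℕ} (M : Matrix (Fin n) (Fin n) (X →L[ℂ] X))
    (x : PiLp 2 (fun _ : Fin n => X)) (i : Fin n) : matOp M x i = ∑ j, M i j (x j) := by
  simp [matOp]

/-- The `π` method set `π^{n,t}_ε(A)`. -/
def piOpen (n : ℕ) (t : Circle) (ε : ℝ) (A : BiSeq X →L[ℂ] BiSeq X) : Set ℂ :=
  ⋃ k : ℤ, specn ε (matOp (perSection A n k t))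

/-- The `π` method set `Π^{n,t}_ε(A)`. -/
def piClosed (n : ℕ) (t : Circle) (ε : ℝ) (A : BiSeq X →L[ℂ] BiSeq X) : Set ℂ :=
  closure (⋃ k : ℤ, Specn ε (matOp (perSection A n k t)))

/-- The penalty `ε'_n = 2 (‖α‖_∞ + ‖γ‖_∞) sin (π / (2n))`. -/
def penalty (A : BiSeq X →L[ℂ] BiSeq X) (n : ℕ) : ℝ :=
  2 * ((⨆ j : ℤ, ‖subdiag A j‖) + ⨆ j : ℤ, ‖superdiag A j‖) * Real.sin (Real.pi / (2 * n))

/-- The `π` method with parameter `t` does not suffer from spectral pollution for `A`. -/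
def NoSpectralPollution (t : Circle) (A : BiSeq X →L[ℂ] BiSeq X) : Prop :=
  ∃ η : ℕ → ℝ, (∀ n, 0 < η n) ∧ Tendsto η atTop (𝓝 0) ∧
    ∀ ε : ℝ, 0 < ε → ∀ n : ℕ, 1 ≤ n → ∀ k : ℤ,
      specn ε (matOp (perSection A n k t)) ⊆ specn (ε + η n) A

end Operators

/-- Hausdorff convergence `S_n → T` of a sequence `(S_n)_{n ≥ 1}` of non-empty bounded subsets of `ℂ`
to a non-empty bounded subset `T`. -/
def HausdorffTendsto (S : ℕ → Set ℂ) (T : Set ℂ) : Prop :=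
  (∀ n : ℕ, 1 ≤ n → (S n).Nonempty ∧ Bornology.IsBounded (S n)) ∧
    (T.Nonempty ∧ Bornology.IsBounded T) ∧
    Tendsto (fun n => Metric.hausdorffDist (S n) T) atTop (𝓝 0)

end PiMethod

end

open PiMethod

/-!
Write `a_d` for the constant value of the `d`-th diagonal. A wave `j ↦ ω ^ j • v` with `|ω| = 1` is
mapped by `A` to the wave `j ↦ ω ^ j • (a₀ + ω⁻¹ a₁ + ω a₋₁) v`, and this symbol decides lower
bounds `ε ‖x‖ ≤ ‖A x‖`: truncated waves transfer such a bound from `A` to the symbol at each `ω`,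
and the discrete Fourier transform, applied to the periodisation of a finitely supported sequence,
transfers it back. In the same way the lower bounds of `A^{per,t}_n` are those of the symbol at the
`n` roots of `ω ^ n = t⁻¹`. Since `‖B⁻¹‖ ≤ 1/ε` means that `ε` is a lower bound for both `B` and its
adjoint, the pseudospectra of `A` are the unions over all `ω` of those of the symbol, and the
pseudospectra of `A^{per,t}_n` the unions over these roots. Every `ω` is within
`2 sin (π / (2n))` of such a root, so the symbol moves by at most the penalty `ε'_n`, which gives
`spec_ε A ⊆ spec_{ε + ε'_n} A^{per,t}_n ⊆ spec_{ε + ε'_n} A`. The closed pseudospectra depend on `ε`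
continuously from the right by compactness, and in a Hilbert space `Spec_ε A` is the closure of
`spec_ε A`.
-/

namespace PiMethod

open scoped InnerProduct

section Banach

variable {Y : Type*} [NormedAddCommGroup Y] [NormedSpace ℂ Y]

/-- The injectivity modulus `inf {‖T x‖ : ‖x‖ = 1}` of `T` is at least `ε`. -/
def BoundedBelow (ε : ℝ) (T : Y →L[ℂ] Y) : Prop :=
  ∀ x, ε * ‖x‖ ≤ ‖T x‖

theorem BoundedBelow.sub_norm_sub {S T : Y →L[ℂ] Y} {ε : ℝ} (hS : BoundedBelow ε S) :
    BoundedBelow (ε - ‖S - T‖) T := fun x => by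
  have h1 : ‖S x‖ ≤ ‖T x‖ + ‖(S - T) x‖ := by simpa using norm_add_le (T x) ((S - T) x)
  linarith [hS x, (S - T).le_opNorm x]

theorem BoundedBelow.eq_zero {T : Y →L[ℂ] Y} {ε : ℝ} (hε : 0 < ε) (hb : BoundedBelow ε T)
    {x : Y} (hx : T x = 0) : x = 0 := by
  have := hb x
  rw [hx, norm_zero] at this
  exact norm_le_zero_iff.1 (nonpos_of_mul_nonpos_right this hε)

theorem norm_ringInverse_le_iff {T : Y →L[ℂ] Y} (hT : IsUnit T) {ε : ℝ} (hε : 0 < ε) :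
    ‖Ring.inverse T‖ ≤ ε⁻¹ ↔ BoundedBelow ε T := by
  have h1 : ∀ x, Ring.inverse T (T x) = x :=
    DFunLike.congr_fun (Ring.inverse_mul_cancel T hT)
  have h2 : ∀ x, T (Ring.inverse T x) = x :=
    DFunLike.congr_fun (Ring.mul_inverse_cancel T hT)
  constructor
  · intro h x
    have := (Ring.inverse T).le_of_opNorm_le h (T x)
    rwa [h1, inv_mul_eq_div, le_div_iff₀' hε] at this
  · refine fun h => ContinuousLinearMap.opNorm_le_bound _ (by positivity) fun y => ?_
    have := h (Ring.inverse T y)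
    rwa [h2, ← le_div_iff₀' hε, ← inv_mul_eq_div] at this

theorem ofReal_le_inv_invNorm_iff {T : Y →L[ℂ] Y} {ε : ℝ} (hε : 0 < ε) :
    ENNReal.ofReal ε ≤ (invNorm T)⁻¹ ↔ IsUnit T ∧ BoundedBelow ε T := by
  by_cases h : IsUnit T
  · rw [← norm_ringInverse_le_iff h hε, invNorm, if_pos h, ENNReal.le_inv_iff_le_inv,
      ← ENNReal.ofReal_inv_of_pos hε, ENNReal.ofReal_le_ofReal_iff (by positivity)]
    exact (and_iff_right h).symm
  · simp [invNorm, h, hε]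

theorem notMem_specn_iff {B : Y →L[ℂ] Y} {ε : ℝ} (hε : 0 < ε) {l : ℂ} :
    l ∉ specn ε B ↔ IsUnit (B - l • ContinuousLinearMap.id ℂ Y) ∧
      BoundedBelow ε (B - l • ContinuousLinearMap.id ℂ Y) := by
  rw [← ofReal_le_inv_invNorm_iff hε, ← not_lt]
  rfl

theorem mem_Specn_iff_forall {B : Y →L[ℂ] Y} {ε : ℝ} (hε : 0 ≤ ε) {l : ℂ} :
    l ∈ Specn ε B ↔ ∀ δ, ε < δ → l ∈ specn δ B := by
  constructor
  · exact fun h δ hδ => lt_of_le_of_lt h ((ENNReal.ofReal_lt_ofReal_iff (hε.trans_lt hδ)).2 hδ)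
  · intro h
    have hlim : Tendsto (fun δ => ENNReal.ofReal δ) (𝓝[>] ε) (𝓝 (ENNReal.ofReal ε)) :=
      (ENNReal.continuous_ofReal.tendsto ε).mono_left nhdsWithin_le_nhds
    exact ge_of_tendsto hlim (eventually_mem_nhdsWithin.mono fun δ hδ => (h δ hδ).le)

theorem Specn_mono (B : Y →L[ℂ] Y) {ε δ : ℝ} (h : ε ≤ δ) : Specn ε B ⊆ Specn δ B :=
  fun _ hl => le_trans hl (ENNReal.ofReal_le_ofReal h)

theorem specn_mono (B : Y →L[ℂ] Y) {ε δ : ℝ} (h : ε ≤ δ) : specn ε B ⊆ specn δ B :=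
  fun _ hl => lt_of_lt_of_le hl (ENNReal.ofReal_le_ofReal h)

theorem specn_subset_Specn (ε : ℝ) (B : Y →L[ℂ] Y) : specn ε B ⊆ Specn ε B :=
  fun _ => le_of_lt (α := ℝ≥0∞)

theorem Specn_subset_specn (B : Y →L[ℂ] Y) {ε δ : ℝ} (hε : 0 ≤ ε) (h : ε < δ) :
    Specn ε B ⊆ specn δ B :=
  fun _ hl => (mem_Specn_iff_forall hε).1 hl δ h

theorem Specn_subset_Specn_of_specn {Z : Type*} [NormedAddCommGroup Z] [NormedSpace ℂ Z]
    {B : Y →L[ℂ] Y} {C : Z →L[ℂ] Z} {ε δ : ℝ} (hε : 0 ≤ ε) (hδ : 0 ≤ δ)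
    (h : ∀ r, 0 < r → specn (ε + r) B ⊆ specn (δ + r) C) : Specn ε B ⊆ Specn δ C := by
  refine fun l hl => (mem_Specn_iff_forall hδ).2 fun s hs => ?_
  have := h (s - δ) (sub_pos.2 hs) (Specn_subset_specn B hε (by linarith) hl)
  rwa [add_sub_cancel] at this

section Perturbation

variable [CompleteSpace Y]

theorem isUnit_of_norm_sub_lt {S T : Y →L[ℂ] Y} (hS : IsUnit S) {ε : ℝ}
    (hb : BoundedBelow ε S) (h : ‖S - T‖ < ε) : IsUnit T := by
  have hε : 0 < ε := (norm_nonneg _).trans_lt h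
  have hsmall : ‖Ring.inverse S * (S - T)‖ < 1 := by
    calc ‖Ring.inverse S * (S - T)‖ ≤ ‖Ring.inverse S‖ * ‖S - T‖ := norm_mul_le _ _
      _ ≤ ε⁻¹ * ‖S - T‖ := by gcongr; exact (norm_ringInverse_le_iff hS hε).2 hb
      _ < 1 := by rwa [inv_mul_lt_one₀ hε]
  have hT : T = S * (1 - Ring.inverse S * (S - T)) := by
    rw [mul_sub, ← mul_assoc, Ring.mul_inverse_cancel S hS]
    simp
  rw [hT]
  exact hS.mul (isUnit_one_sub_of_norm_lt_one hsmall)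

theorem inv_invNorm_le_add (S T : Y →L[ℂ] Y) : (invNorm S)⁻¹ ≤ (invNorm T)⁻¹ + ‖S - T‖ₑ := by
  by_contra! h
  obtain ⟨r, -, hr, hrS⟩ := ENNReal.lt_iff_exists_real_btwn.1 h
  rw [← ofReal_norm] at hr
  have hST : ‖S - T‖ < r := by
    by_contra! hle
    exact absurd (ENNReal.ofReal_le_ofReal hle) (not_le.2 (le_add_self.trans_lt hr))
  obtain ⟨hS, hb⟩ := (ofReal_le_inv_invNorm_iff ((norm_nonneg _).trans_lt hST)).1 hrS.le
  refine hr.not_ge ?_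
  calc ENNReal.ofReal r = ENNReal.ofReal (r - ‖S - T‖) + ENNReal.ofReal ‖S - T‖ := by
        rw [← ENNReal.ofReal_add (by linarith) (norm_nonneg _), sub_add_cancel]
    _ ≤ (invNorm T)⁻¹ + ENNReal.ofReal ‖S - T‖ := by
        gcongr
        exact (ofReal_le_inv_invNorm_iff (sub_pos.2 hST)).2
          ⟨isUnit_of_norm_sub_lt hS hb hST, hb.sub_norm_sub⟩

theorem continuous_inv_invNorm : Continuous fun T : Y →L[ℂ] Y => (invNorm T)⁻¹ :=
  continuous_of_le_add_edist 1 (by simp) fun S T => by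
    rw [one_mul, edist_eq_enorm_sub]
    exact inv_invNorm_le_add S T

theorem isClosed_Specn (ε : ℝ) (B : Y →L[ℂ] Y) : IsClosed (Specn ε B) :=
  isClosed_le (continuous_inv_invNorm.comp (by fun_prop)) continuous_const

theorem isClosed_setOf_mem_Specn (ε : ℝ) (l : ℂ) :
    IsClosed {T : Y →L[ℂ] Y | l ∈ Specn ε T} :=
  isClosed_le (continuous_inv_invNorm.comp (by fun_prop)) continuous_const

theorem specn_subset_specn_add {S T : Y →L[ℂ] Y} {ε r : ℝ} (hε : 0 ≤ ε) (h : ‖T - S‖ ≤ r) :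
    specn ε S ⊆ specn (ε + r) T := fun l hl => by
  have hr : 0 ≤ r := (norm_nonneg _).trans h
  have hle := inv_invNorm_le_add (T - l • ContinuousLinearMap.id ℂ Y)
    (S - l • ContinuousLinearMap.id ℂ Y)
  rw [sub_sub_sub_cancel_right, ← ofReal_norm] at hle
  refine hle.trans_lt ?_
  rw [ENNReal.ofReal_add hε hr]
  exact ENNReal.add_lt_add_of_lt_of_le ENNReal.ofReal_ne_top hl (ENNReal.ofReal_le_ofReal h)

theorem norm_le_of_mem_Specn {B : Y →L[ℂ] Y} {ε : ℝ} (hε : 0 ≤ ε) {l : ℂ}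
    (hl : l ∈ Specn ε B) : ‖l‖ ≤ ε + ‖B‖ := by
  by_contra! h
  have hl0 : l ≠ 0 := norm_pos_iff.1 (by linarith [norm_nonneg B])
  have hS : IsUnit (-(l • ContinuousLinearMap.id ℂ Y)) :=
    ((isUnit_one (M := Y →L[ℂ] Y)).smul (Units.mk0 l hl0)).neg
  have hb : BoundedBelow ‖l‖ (-(l • ContinuousLinearMap.id ℂ Y)) := fun x => by
    simp [norm_smul]
  have hdist :
      ‖-(l • ContinuousLinearMap.id ℂ Y) - (B - l • ContinuousLinearMap.id ℂ Y)‖ = ‖B‖ := by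
    rw [← norm_neg]
    congr 1
    abel
  have hle : ENNReal.ofReal (‖l‖ - ‖B‖) ≤ ENNReal.ofReal ε :=
    ((ofReal_le_inv_invNorm_iff (by linarith)).2 ⟨isUnit_of_norm_sub_lt hS hb (by linarith),
      hdist ▸ hb.sub_norm_sub⟩).trans hl
  linarith [(ENNReal.ofReal_le_ofReal_iff hε).1 hle]

theorem isBounded_Specn (ε : ℝ) (B : Y →L[ℂ] Y) : Bornology.IsBounded (Specn ε B) :=
  (isBounded_iff_forall_norm_le.2
    ⟨_, fun _ => norm_le_of_mem_Specn (le_max_right ε 0)⟩).subset (Specn_mono B (le_max_left ε 0))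

theorem isCompact_Specn (ε : ℝ) (B : Y →L[ℂ] Y) : IsCompact (Specn ε B) :=
  Metric.isCompact_of_isClosed_isBounded (isClosed_Specn ε B) (isBounded_Specn ε B)

theorem exists_mem_Specn_of_forall_exists_mem_specn {K : Type*} [TopologicalSpace K]
    [CompactSpace K] {T : K → Y →L[ℂ] Y} (hT : Continuous T) {ε : ℝ} (hε : 0 ≤ ε) {l : ℂ}
    (h : ∀ δ, ε < δ → ∃ k, l ∈ specn δ (T k)) : ∃ k, l ∈ Specn ε (T k) := by
  let F : Set.Ioi ε → Set K := fun δ => {k | l ∈ Specn δ (T k)}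
  have hclosed : ∀ δ, IsClosed (F δ) := fun δ => (isClosed_setOf_mem_Specn _ l).preimage hT
  have hdir : Directed (· ⊇ ·) F := fun a b =>
    ⟨min a b, fun _ hk => Specn_mono _ (min_le_left _ _) hk,
      fun _ hk => Specn_mono _ (min_le_right _ _) hk⟩
  have : Nonempty (Set.Ioi ε) := ⟨⟨ε + 1, by simp⟩⟩
  obtain ⟨k, hk⟩ := IsCompact.nonempty_iInter_of_directed_nonempty_isCompact_isClosed F hdir
    (fun δ => (h δ δ.2).imp fun k hk => specn_subset_Specn _ _ hk)
    (fun δ => (hclosed δ).isCompact) hclosed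
  refine ⟨k, (mem_Specn_iff_forall hε).2 fun δ hδ => ?_⟩
  obtain ⟨s, hs, hsδ⟩ := exists_between hδ
  exact Specn_subset_specn _ (hε.trans hs.le) hsδ (Set.mem_iInter.1 hk ⟨s, hs⟩)

theorem exists_Specn_subset_thickening (B : Y →L[ℂ] Y) {ε r : ℝ} (hε : 0 ≤ ε) (hr : 0 < r) :
    ∃ δ, ε < δ ∧ Specn δ B ⊆ Metric.thickening r (Specn ε B) := by
  have : Nonempty (Set.Ioi ε) := ⟨⟨ε + 1, by simp⟩⟩
  obtain ⟨δ, hδ⟩ := exists_subset_nhds_of_isCompact' (V := fun δ : Set.Ioi ε => Specn (δ : ℝ) B)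
    (U := Metric.thickening r (Specn ε B))
    (fun a b => ⟨min a b, Specn_mono B (min_le_left _ _), Specn_mono B (min_le_right _ _)⟩)
    (fun δ => isCompact_Specn δ B) (fun δ => isClosed_Specn δ B) (fun l hl => by
      refine Metric.isOpen_thickening.mem_nhds (Metric.self_subset_thickening hr _ ?_)
      refine (mem_Specn_iff_forall hε).2 fun δ hδ => ?_
      obtain ⟨s, hs, hsδ⟩ := exists_between hδ
      exact Specn_subset_specn _ (hε.trans hs.le) hsδ (Set.mem_iInter.1 hl ⟨s, hs⟩))
  exact ⟨δ, δ.2, hδ⟩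

theorem hausdorffTendsto_of_subset_Specn (B : Y →L[ℂ] Y) {ε : ℝ} (hε : 0 ≤ ε) {d : ℕ → ℝ}
    (hd : Tendsto d atTop (𝓝 0)) {S : ℕ → Set ℂ} {T : Set ℂ} (hT0 : T.Nonempty)
    (hT : T ⊆ Specn ε B) (hT' : Specn ε B ⊆ closure T) (hTS : ∀ n, 1 ≤ n → T ⊆ S n)
    (hS : ∀ n, 1 ≤ n → S n ⊆ Specn (ε + d n) B) : HausdorffTendsto S T := by
  refine ⟨fun n hn => ⟨hT0.mono (hTS n hn), (isBounded_Specn _ B).subset (hS n hn)⟩,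
    ⟨hT0, (isBounded_Specn ε B).subset hT⟩, ?_⟩
  rw [Metric.tendsto_atTop]
  intro r hr
  obtain ⟨δ, hδ, hsub⟩ := exists_Specn_subset_thickening B hε (half_pos hr)
  obtain ⟨N, hN⟩ := eventually_atTop.1 (hd.eventually_lt_const (sub_pos.2 hδ))
  refine ⟨max N 1, fun n hn => ?_⟩
  have hnN : d n < δ - ε := hN n ((le_max_left _ _).trans hn)
  have hn1 : 1 ≤ n := (le_max_right _ _).trans hn
  rw [Real.dist_0_eq_abs, abs_of_nonneg Metric.hausdorffDist_nonneg]
  refine lt_of_le_of_lt (Metric.hausdorffDist_le_of_mem_dist (half_pos hr).le ?_ ?_)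
    (half_lt_self hr)
  · intro l hl
    have hl' : l ∈ Metric.thickening (r / 2) (closure T) :=
      Metric.thickening_subset_of_subset (r / 2) hT'
        (hsub (Specn_mono B (by linarith) (hS n hn1 hl)))
    rw [Metric.thickening_closure] at hl'
    obtain ⟨m, hm, hlm⟩ := Metric.mem_thickening_iff.1 hl'
    exact ⟨m, hm, hlm.le⟩
  · exact fun l hl => ⟨l, hTS n hn1 hl, by rw [dist_self]; positivity⟩

theorem nonempty_Specn [Nontrivial Y] (B : Y →L[ℂ] Y) {ε : ℝ} (hε : 0 ≤ ε) :
    (Specn ε B).Nonempty :=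
  (spectrum.nonempty B).mono (Specn_zero B ▸ Specn_mono B hε)

end Perturbation

end Banach

section InnerProduct

variable {H : Type*} [NormedAddCommGroup H] [InnerProductSpace ℂ H]

/- Average the bound `ε * ‖(T + h) w‖ ≤ ‖(T - h) (T + h) w‖ = ‖T² w - h² w‖` over the four points
`h = ±r, ±ir`, with the parallelogram law on both sides. -/
theorem sq_mul_add_le_of_boundedBelow_on_circle {T : H →L[ℂ] H} {ε r : ℝ} (hε : 0 ≤ ε)
    (h : ∀ z : ℂ, ‖z‖ = |r| → BoundedBelow ε (T - z • ContinuousLinearMap.id ℂ H)) (w : H) :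
    ε ^ 2 * (‖T w‖ ^ 2 + r ^ 2 * ‖w‖ ^ 2) ≤ ‖T (T w)‖ ^ 2 + r ^ 4 * ‖w‖ ^ 2 := by
  have hpoint : ∀ z : ℂ, ‖z‖ = |r| →
      ε ^ 2 * ‖T w + z • w‖ ^ 2 ≤ ‖T (T w) - z ^ 2 • w‖ ^ 2 := fun z hz => by
    have hfactor : (T - z • ContinuousLinearMap.id ℂ H) (T w + z • w) = T (T w) - z ^ 2 • w := by
      simp only [sub_apply, smul_apply, ContinuousLinearMap.id_apply, map_add, map_smul, sq,
        mul_smul]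
      module
    rw [← mul_pow, ← hfactor]
    gcongr
    exact h z hz _
  have hpair : ∀ z : ℂ, ‖z‖ = |r| →
      ε ^ 2 * (‖T w‖ ^ 2 + r ^ 2 * ‖w‖ ^ 2) ≤ ‖T (T w) - z ^ 2 • w‖ ^ 2 := fun z hz => by
    have hsum := parallelogram_law_with_norm ℂ (T w) (z • w)
    have h1 := hpoint z hz
    have h2 := hpoint (-z) (by rwa [norm_neg])
    rw [neg_sq, neg_smul, ← sub_eq_add_neg] at h2
    rw [norm_smul, hz, mul_pow, sq_abs] at hsum
    nlinarith
  have hsum := parallelogram_law_with_norm ℂ (T (T w)) (((r : ℂ) ^ 2) • w)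
  rw [norm_smul, norm_pow, Complex.norm_real, Real.norm_eq_abs, sq_abs] at hsum
  have h1 := hpair r (by simp)
  have h2 := hpair (Complex.I * r) (by simp)
  rw [mul_pow, Complex.I_sq, neg_one_mul, neg_smul, sub_neg_eq_add] at h2
  nlinarith

theorem exists_lt_boundedBelow {T : H →L[ℂ] H} (hT : Function.Surjective T) {ε r : ℝ}
    (hr : 0 < r) (hrε : r < ε)
    (h : ∀ z : ℂ, ‖z‖ = r → BoundedBelow ε (T - z • ContinuousLinearMap.id ℂ H)) :
    ∃ δ, ε < δ ∧ BoundedBelow δ T := by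
  have hε : 0 < ε := hr.trans hrε
  set c : ℝ := r ^ 2 * (ε ^ 2 - r ^ 2) / (‖T‖ ^ 2 + 1) with hc
  have hc0 : 0 < c := by
    have : r ^ 2 < ε ^ 2 := by gcongr
    have : 0 < ε ^ 2 - r ^ 2 := by linarith
    positivity
  refine ⟨√(ε ^ 2 + c), Real.lt_sqrt_of_sq_lt (by linarith), fun u => ?_⟩
  obtain ⟨w, rfl⟩ := hT u
  have hmean := sq_mul_add_le_of_boundedBelow_on_circle hε.le (r := r)
    (by simpa only [abs_of_pos hr] using h) w
  have hgain : c * ‖T w‖ ^ 2 ≤ r ^ 2 * (ε ^ 2 - r ^ 2) * ‖w‖ ^ 2 := by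
    have hle : ‖T w‖ ^ 2 ≤ (‖T‖ ^ 2 + 1) * ‖w‖ ^ 2 := by
      nlinarith [pow_le_pow_left₀ (norm_nonneg _) (T.le_opNorm w) 2, sq_nonneg ‖w‖]
    calc c * ‖T w‖ ^ 2 ≤ c * ((‖T‖ ^ 2 + 1) * ‖w‖ ^ 2) := by gcongr
      _ = r ^ 2 * (ε ^ 2 - r ^ 2) * ‖w‖ ^ 2 := by
        rw [← mul_assoc, hc, div_mul_cancel₀ _ (by positivity)]
  refine le_of_sq_le_sq ?_ (norm_nonneg _)
  rw [mul_pow, Real.sq_sqrt (by positivity)]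
  linarith

theorem Specn_subset_closure_specn (B : H →L[ℂ] H) {ε : ℝ} (hε : 0 < ε) :
    Specn ε B ⊆ closure (specn ε B) := by
  intro l hl
  by_contra hcl
  obtain ⟨ρ, hρ, hball⟩ := Metric.isOpen_iff.1 isClosed_closure.isOpen_compl l hcl
  have hout : ∀ z, ‖z‖ < ρ → l + z ∉ specn ε B := fun z hz hz' =>
    hball (by simpa using hz) (subset_closure hz')
  obtain ⟨hunit, -⟩ := (notMem_specn_iff hε).1 (hout 0 (by simpa))
  rw [add_zero] at hunit
  obtain ⟨r, hr, hrmin⟩ := exists_between (lt_min hε hρ)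
  have hsurj : Function.Surjective (B - l • ContinuousLinearMap.id ℂ H) := fun u =>
    ⟨_, DFunLike.congr_fun (Ring.mul_inverse_cancel _ hunit) u⟩
  obtain ⟨δ, hεδ, hδ⟩ := exists_lt_boundedBelow hsurj hr (lt_min_iff.1 hrmin).1 fun z hz => by
      have := ((notMem_specn_iff hε).1 (hout z (hz ▸ (lt_min_iff.1 hrmin).2))).2
      rwa [add_smul, ← sub_sub] at this
  exact (notMem_specn_iff (hε.trans hεδ)).2 ⟨hunit, hδ⟩ (Specn_subset_specn B hε.le hεδ hl)

section Adjoint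

variable [CompleteSpace H]

theorem boundedBelow_adjoint {T : H →L[ℂ] H} (hT : IsUnit T) {ε : ℝ} (hε : 0 < ε)
    (hb : BoundedBelow ε T) : BoundedBelow ε (T†) := by
  rw [← ContinuousLinearMap.star_eq_adjoint, ← norm_ringInverse_le_iff hT.star hε,
    Ring.inverse_star, norm_star]
  exact (norm_ringInverse_le_iff hT hε).2 hb

theorem isUnit_and_boundedBelow_iff {T : H →L[ℂ] H} {ε : ℝ} (hε : 0 < ε) :
    IsUnit T ∧ BoundedBelow ε T ↔ BoundedBelow ε T ∧ BoundedBelow ε (T†) := by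
  refine ⟨fun ⟨hT, hb⟩ => ⟨hb, boundedBelow_adjoint hT hε hb⟩, fun ⟨hb, hb'⟩ => ⟨?_, hb⟩⟩
  rw [ContinuousLinearMap.isUnit_iff_bijective,
    ContinuousLinearMap.bijective_iff_dense_range_and_antilipschitz]
  refine ⟨?_, ⟨ε⁻¹, by positivity⟩, ContinuousLinearMap.antilipschitz_of_bound _ fun x => ?_⟩
  · rw [Submodule.topologicalClosure_eq_top_iff, ContinuousLinearMap.orthogonal_range,
      Submodule.eq_bot_iff]
    exact fun x hx => hb'.eq_zero hε hx
  · change ‖x‖ ≤ ε⁻¹ * ‖T x‖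
    rw [inv_mul_eq_div, le_div_iff₀' hε]
    exact hb x

theorem notMem_specn_iff_boundedBelow {B : H →L[ℂ] H} {ε : ℝ} (hε : 0 < ε) {l : ℂ} :
    l ∉ specn ε B ↔ BoundedBelow ε (B - l • ContinuousLinearMap.id ℂ H) ∧
      BoundedBelow ε ((B - l • ContinuousLinearMap.id ℂ H)†) := by
  rw [notMem_specn_iff hε, isUnit_and_boundedBelow_iff hε]

end Adjoint

end InnerProduct

section Laurent

variable {X : Type*} [NormedAddCommGroup X] [NormedSpace ℂ X]

/-- The action of a tridiagonal block Laurent operator on an arbitrary, not necessarily square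
summable, sequence. -/
noncomputable def laurentApply (A : BiSeq X →L[ℂ] BiSeq X) (f : ℤ → X) (i : ℤ) : X :=
  entry A 0 0 (f i) + entry A 1 0 (f (i - 1)) + entry A (-1) 0 (f (i + 1))

/-- The symbol `a₀ + ω⁻¹ a₁ + ω a₋₁` of a tridiagonal block Laurent operator with diagonals
`a_d = a_{j+d,j}`. -/
noncomputable def symbol (A : BiSeq X →L[ℂ] BiSeq X) (w : Circle) : X →L[ℂ] X :=
  entry A 0 0 + w⁻¹ • entry A 1 0 + w • entry A (-1) 0

/-- The sequences `f` with `f (i + n) = t⁻¹ f i`, on which a tridiagonal block Laurent operator acts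
like its periodised section `A^{per,t}_{n,0}`. -/
def IsTwistedPeriodic (n : ℕ) (t : Circle) (f : ℤ → X) : Prop :=
  ∀ i, f (i + n) = t⁻¹ • f i

theorem IsBlockLaurent.entry_eq {A : BiSeq X →L[ℂ] BiSeq X} (hL : IsBlockLaurent A) (i j : ℤ) :
    entry A i j = entry A (i - j) 0 := by
  obtain ⟨c, hc⟩ := hL (i - j)
  have h1 := hc j
  have h2 := hc 0
  rw [add_sub_cancel] at h1
  rw [zero_add] at h2
  rw [h1, h2]

theorem IsBlockLaurent.perSection_eq {A : BiSeq X →L[ℂ] BiSeq X} (hL : IsBlockLaurent A)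
    (k : ℤ) (n : ℕ) (t : Circle) : perSection A n k t = perSection A n 0 t := by
  ext1 i j
  simp only [perSection, finSection, cornerMatrix, subdiag, superdiag, Matrix.add_apply,
    Matrix.of_apply]
  rw [hL.entry_eq (k + 1 + _), hL.entry_eq (0 + 1 + _), hL.entry_eq (k + 1) k,
    hL.entry_eq (0 + 1) 0, hL.entry_eq (k + n + 1 - 1), hL.entry_eq (0 + (n : ℤ) + 1 - 1),
    add_sub_add_left_eq_sub, add_sub_add_left_eq_sub, add_sub_cancel_left, add_sub_cancel_left,
    sub_sub_cancel_left, sub_sub_cancel_left]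

theorem laurentApply_wave (A : BiSeq X →L[ℂ] BiSeq X) (w : Circle) (v : X) (i : ℤ) :
    laurentApply A (fun j => w ^ j • v) i = w ^ i • symbol A w v := by
  simp only [laurentApply, symbol, zpow_sub_one, zpow_add_one, mul_smul, Circle.smul_def, map_smul,
    add_apply, smul_apply, smul_add]

theorem isTwistedPeriodic_wave {n : ℕ} {t w : Circle} (hw : w ^ n = t⁻¹) (v : X) :
    IsTwistedPeriodic n t fun i => w ^ i • v := fun i => by
  simp only [zpow_add, zpow_natCast, hw, mul_comm _ t⁻¹, mul_smul]

theorem exists_isTwistedPeriodic {n : ℕ} (t : Circle) (hn : 1 ≤ n) (y : Fin n → X) :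
    ∃ f : ℤ → X, IsTwistedPeriodic n t f ∧ ∀ i : Fin n, f (i : ℕ) = y i := by
  have hn0 : (n : ℤ) ≠ 0 := by omega
  have hmod : ∀ i : ℤ, (i % n).toNat < n := fun i => by
    have := Int.emod_lt_of_pos i (show (0 : ℤ) < n by omega)
    omega
  refine ⟨fun i => t ^ (-(i / n)) • y ⟨(i % n).toNat, hmod i⟩, fun i => ?_, fun i => ?_⟩
  · simp only [Int.add_emod_right, Int.add_ediv_of_dvd_right (dvd_refl (n : ℤ)),
      Int.ediv_self hn0]
    rw [neg_add, zpow_add, zpow_neg_one, mul_comm, mul_smul]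
  · have hi : ((i : ℕ) : ℤ) < n := by exact_mod_cast i.isLt
    simp [Int.ediv_eq_zero_of_lt (Int.natCast_nonneg _) hi,
      Int.emod_eq_of_lt (Int.natCast_nonneg _) hi]

theorem IsTridiagonal.sum_entry_apply {A : BiSeq X →L[ℂ] BiSeq X} (hA : IsTridiagonal A)
    (hL : IsBlockLaurent A) (f : ℤ → X) {i : ℤ} {s : Finset ℤ} (hs : {i, i - 1, i + 1} ⊆ s) :
    ∑ j ∈ s, entry A i j (f j) = laurentApply A f i := by
  have hfar : ∀ j ∉ ({i, i - 1, i + 1} : Finset ℤ), entry A i j (f j) = 0 := fun j hj => by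
    simp only [Finset.mem_insert, Finset.mem_singleton, not_or] at hj
    rw [hA i j (by rw [lt_abs]; omega), zero_apply]
  rw [← Finset.sum_subset hs fun j _ hj => hfar j hj, Finset.sum_insert (by simp; omega),
    Finset.sum_insert (by simp; omega), Finset.sum_singleton, hL.entry_eq i i,
    hL.entry_eq i (i - 1), hL.entry_eq i (i + 1), ← add_assoc, laurentApply]
  congr 3 <;> ring_nf

theorem IsTridiagonal.apply_apply {A : BiSeq X →L[ℂ] BiSeq X} (hA : IsTridiagonal A)
    (hL : IsBlockLaurent A) (x : BiSeq X) (i : ℤ) : A x i = laurentApply A x i := by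
  have hsum : HasSum (fun j => entry A i j (x j)) (A x i) :=
    (lp.hasSum_single (by norm_num) x).mapL ((lp.evalCLM ℂ (fun _ : ℤ => X) 2 i).comp A)
  refine tendsto_nhds_unique hsum (tendsto_const_nhds.congr' ?_)
  filter_upwards [Filter.eventually_ge_atTop {i, i - 1, i + 1}] with s hs
  exact (hA.sum_entry_apply hL x hs).symm

theorem sum_cornerMatrix_apply {A : BiSeq X →L[ℂ] BiSeq X} (hA : IsTridiagonal A)
    (hL : IsBlockLaurent A) {n : ℕ} {t : Circle} {f : ℤ → X} (hf : IsTwistedPeriodic n t f)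
    (i : Fin n) :
    ∑ j : Fin n, cornerMatrix A n 0 t i j (f (j : ℕ)) =
      entry A (i : ℕ) (-1) (f (-1)) + entry A (i : ℕ) n (f n) := by
  have hi := i.isLt
  have hn : n - 1 + 1 = n := by omega
  have hlast : ((n - 1 : ℕ) : ℤ) = -1 + n := by omega
  have hleft : ∑ j : Fin n, (if (i : ℕ) = 0 ∧ (j : ℕ) + 1 = n then (t : ℂ) • subdiag A 0 else 0)
      (f (j : ℕ)) = entry A (i : ℕ) (-1) (f (-1)) := by
    rw [Finset.sum_eq_single ⟨n - 1, by omega⟩ (fun j _ hj => ?_) (by simp)]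
    · by_cases h0 : (i : ℕ) = 0
      · simp [h0, hn, hlast, hf (-1), subdiag, hL.entry_eq 0 (-1), Circle.smul_def, smul_smul]
      · simp [h0, hA (i : ℕ) (-1) (by rw [lt_abs]; omega)]
    · have : (j : ℕ) + 1 ≠ n := fun h => hj (Fin.ext (by simp; omega))
      simp [this]
  have hright : ∑ j : Fin n, (if (i : ℕ) + 1 = n ∧ (j : ℕ) = 0 then
      (starRingEnd ℂ (t : ℂ)) • superdiag A (0 + n + 1) else 0) (f (j : ℕ)) =
        entry A (i : ℕ) n (f n) := by
    rw [Finset.sum_eq_single ⟨0, by omega⟩ (fun j _ hj => ?_) (by simp)]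
    · by_cases h1 : (i : ℕ) + 1 = n
      · have h0 : f n = t⁻¹ • f 0 := by simpa using hf 0
        have hrow : entry A (i : ℕ) n = entry A (-1) 0 := by
          rw [hL.entry_eq]
          congr 1
          omega
        have hsup : superdiag A (n + 1) = entry A (-1) 0 := by
          rw [superdiag, hL.entry_eq, sub_sub_cancel_left]
        simp [h0, h1, hrow, hsup, Circle.smul_def, ← Circle.coe_inv_eq_conj]
      · simp [h1, hA (i : ℕ) n (by rw [lt_abs]; omega)]
    · have : (j : ℕ) ≠ 0 := fun h => hj (Fin.ext h)
      simp [this]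
  rw [← hleft, ← hright, ← Finset.sum_add_distrib]
  rfl

theorem matOp_perSection_apply {A : BiSeq X →L[ℂ] BiSeq X} (hA : IsTridiagonal A)
    (hL : IsBlockLaurent A) {n : ℕ} {t : Circle} {f : ℤ → X} (hf : IsTwistedPeriodic n t f) :
    matOp (perSection A n 0 t) (WithLp.toLp 2 fun i : Fin n => f (i : ℕ)) =
      WithLp.toLp 2 fun i : Fin n => laurentApply A f (i : ℕ) := by
  ext i
  let s : Finset ℤ := insert (-1) (insert (n : ℤ) (Finset.univ.image fun j : Fin n => (j : ℤ)))
  have hs : {((i : ℕ) : ℤ), ((i : ℕ) : ℤ) - 1, ((i : ℕ) : ℤ) + 1} ⊆ s := by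
    intro k hk
    have : 0 ≤ k → k < n → ∃ j : Fin n, ((j : ℕ) : ℤ) = k := fun h0 hn =>
      ⟨⟨k.toNat, by omega⟩, by simp [h0]⟩
    simp only [s, Finset.mem_insert, Finset.mem_singleton, Finset.mem_image, Finset.mem_univ,
      true_and] at hk ⊢
    have := i.isLt
    grind
  have hentry : ∀ j : Fin n, finSection A n 0 i j = entry A (i : ℕ) (j : ℕ) := fun j => by
    rw [finSection, Matrix.of_apply, hL.entry_eq, hL.entry_eq (i : ℕ), add_sub_add_left_eq_sub]
  change _ = laurentApply A f (i : ℕ)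
  rw [matOp_apply, ← hA.sum_entry_apply hL f hs, Finset.sum_insert, Finset.sum_insert,
    Finset.sum_image]
  · simp only [perSection, Matrix.add_apply, add_apply, Finset.sum_add_distrib, hentry,
      sum_cornerMatrix_apply hA hL hf]
    abel
  · intro j _ k _ hjk
    exact Fin.ext (Int.ofNat_inj.1 hjk)
  · simp [Fin.exists_iff]
  · simp

end Laurent

section Shift

variable {X : Type*} [NormedAddCommGroup X] [NormedSpace ℂ X]

theorem entry_sub_smul_id (A : BiSeq X →L[ℂ] BiSeq X) (l : ℂ) (i j : ℤ) :
    entry (A - l • ContinuousLinearMap.id ℂ (BiSeq X)) i j =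
      entry A i j - if i = j then l • ContinuousLinearMap.id ℂ X else 0 := by
  ext x
  change (A (lp.single 2 j x) - l • lp.single 2 j x : BiSeq X) i = _
  rw [lp.coeFn_sub, lp.coeFn_smul, Pi.sub_apply, Pi.smul_apply, sub_apply, entry_apply]
  split_ifs with h
  · subst h
    simp
  · simp [h]

theorem IsTridiagonal.sub_smul_id {A : BiSeq X →L[ℂ] BiSeq X} (hA : IsTridiagonal A) (l : ℂ) :
    IsTridiagonal (A - l • ContinuousLinearMap.id ℂ (BiSeq X)) := fun i j hij => by
  rw [entry_sub_smul_id, hA i j hij, if_neg (by rintro rfl; simp at hij), sub_zero]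

theorem IsBlockLaurent.sub_smul_id {A : BiSeq X →L[ℂ] BiSeq X} (hL : IsBlockLaurent A) (l : ℂ) :
    IsBlockLaurent (A - l • ContinuousLinearMap.id ℂ (BiSeq X)) := fun d =>
  ⟨entry (A - l • ContinuousLinearMap.id ℂ (BiSeq X)) d 0, fun j => by
    simp only [entry_sub_smul_id, hL.entry_eq (j + d), add_sub_cancel_left, add_eq_left]⟩

theorem symbol_sub_smul_id (A : BiSeq X →L[ℂ] BiSeq X) (l : ℂ) (w : Circle) :
    symbol (A - l • ContinuousLinearMap.id ℂ (BiSeq X)) w =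
      symbol A w - l • ContinuousLinearMap.id ℂ X := by
  simp only [symbol, entry_sub_smul_id, if_true, one_ne_zero, neg_eq_zero, if_false, sub_zero]
  abel

theorem perSection_sub_smul_id (A : BiSeq X →L[ℂ] BiSeq X) (l : ℂ) (n : ℕ) (t : Circle)
    (i j : Fin n) :
    perSection (A - l • ContinuousLinearMap.id ℂ (BiSeq X)) n 0 t i j =
      perSection A n 0 t i j - if i = j then l • ContinuousLinearMap.id ℂ X else 0 := by
  simp only [perSection, finSection, cornerMatrix, subdiag, superdiag, entry_sub_smul_id,
    Matrix.add_apply, Matrix.of_apply, add_right_inj, Nat.cast_inj, Fin.val_inj, add_eq_left,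
    sub_eq_self, one_ne_zero, if_false, sub_zero]
  abel

theorem matOp_perSection_sub_smul_id (A : BiSeq X →L[ℂ] BiSeq X) (l : ℂ) (n : ℕ) (t : Circle) :
    matOp (perSection (A - l • ContinuousLinearMap.id ℂ (BiSeq X)) n 0 t) =
      matOp (perSection A n 0 t) -
        l • ContinuousLinearMap.id ℂ (PiLp 2 fun _ : Fin n => X) := by
  ext x i
  have hdiag : ∀ j : Fin n, (if i = j then l • ContinuousLinearMap.id ℂ X else 0) (x j) =
      if i = j then l • x j else 0 := fun j => by
    split_ifs <;> simp
  rw [sub_apply, PiLp.sub_apply, matOp_apply, matOp_apply]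
  simp only [perSection_sub_smul_id, sub_apply, hdiag, Finset.sum_sub_distrib, Finset.sum_ite_eq,
    Finset.mem_univ, if_true, smul_apply, ContinuousLinearMap.id_apply, PiLp.smul_apply]

end Shift

section Adjoint

variable {X : Type*} [NormedAddCommGroup X] [InnerProductSpace ℂ X] [CompleteSpace X]

theorem entry_adjoint (A : BiSeq X →L[ℂ] BiSeq X) (i j : ℤ) : entry (A†) i j = (entry A j i)† := by
  refine (ContinuousLinearMap.eq_adjoint_iff _ _).2 fun x y => ?_
  have hy := lp.inner_single_right (𝕜 := ℂ) i y ((A†) (lp.single 2 j x))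
  have hx := lp.inner_single_left (𝕜 := ℂ) j x (A (lp.single 2 i y))
  rw [entry_apply, entry_apply, ← hy, ← hx, ContinuousLinearMap.adjoint_inner_left]

theorem IsTridiagonal.adjoint {A : BiSeq X →L[ℂ] BiSeq X} (hA : IsTridiagonal A) :
    IsTridiagonal (A†) := fun i j h => by
  rw [entry_adjoint, hA j i (by rwa [abs_sub_comm]), map_zero]

theorem IsBlockLaurent.adjoint {A : BiSeq X →L[ℂ] BiSeq X} (hL : IsBlockLaurent A) :
    IsBlockLaurent (A†) := fun d =>
  ⟨(entry A (-d) 0)†, fun j => by rw [entry_adjoint, hL.entry_eq, sub_add_cancel_left]⟩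

theorem symbol_adjoint {A : BiSeq X →L[ℂ] BiSeq X} (hL : IsBlockLaurent A) (w : Circle) :
    symbol (A†) w = (symbol A w)† := by
  simp only [symbol, entry_adjoint, Circle.smul_def, map_add, map_smulₛₗ,
    ← Circle.coe_inv_eq_conj, inv_inv]
  rw [hL.entry_eq 0 1, hL.entry_eq 0 (-1), zero_sub, zero_sub, neg_neg, add_right_comm]

theorem matOp_adjoint {n : ℕ} {M N : Matrix (Fin n) (Fin n) (X →L[ℂ] X)}
    (h : ∀ i j, N i j = (M j i)†) : matOp N = (matOp M)† := by
  refine (ContinuousLinearMap.eq_adjoint_iff _ _).2 fun x y => ?_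
  simp only [PiLp.inner_apply, matOp_apply, sum_inner, inner_sum, h,
    ContinuousLinearMap.adjoint_inner_left]
  exact Finset.sum_comm

theorem perSection_adjoint {A : BiSeq X →L[ℂ] BiSeq X} (hL : IsBlockLaurent A) (n : ℕ)
    (t : Circle) (i j : Fin n) : perSection (A†) n 0 t i j = (perSection A n 0 t j i)† := by
  have hsub : subdiag (A†) 0 = (superdiag A (0 + n + 1))† := by
    rw [subdiag, superdiag, entry_adjoint, hL.entry_eq, hL.entry_eq (0 + (n : ℤ) + 1 - 1)]
    congr 2
    omega
  have hsup : superdiag (A†) (0 + n + 1) = (subdiag A 0)† := by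
    rw [subdiag, superdiag, entry_adjoint, hL.entry_eq, hL.entry_eq (0 + 1)]
    congr 2
    omega
  simp only [perSection, finSection, cornerMatrix, Matrix.add_apply, Matrix.of_apply, map_add,
    entry_adjoint, hsub, hsup, apply_ite ContinuousLinearMap.adjoint, map_smulₛₗ, map_zero,
    Complex.conj_conj]
  rw [add_comm (ite _ _ _)]
  simp only [and_comm]

end Adjoint

section Fourier

theorem exists_circle_pow_eq {n : ℕ} (hn : 1 ≤ n) (t : Circle) : ∃ w : Circle, w ^ n = t := by
  refine ⟨Circle.exp (Complex.arg t / n), ?_⟩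
  have : (n : ℝ) ≠ 0 := by positivity
  rw [← Circle.exp_nsmul, nsmul_eq_mul, mul_div_cancel₀ _ this, Circle.exp_arg]

theorem exists_circle_isPrimitiveRoot {n : ℕ} (hn : 1 ≤ n) : ∃ z : Circle, IsPrimitiveRoot z n := by
  refine ⟨Circle.exp (2 * Real.pi / n),
    IsPrimitiveRoot.of_map_of_injective (f := Circle.coeHom) ?_ Subtype.val_injective⟩
  convert Complex.isPrimitiveRoot_exp n (by omega) using 1
  change ((Circle.exp (2 * Real.pi / n) : Circle) : ℂ) = _
  rw [Circle.coe_exp]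
  push_cast
  ring_nf

theorem sum_conj_zpow_mul_zpow {n : ℕ} {z : Circle} (hz : IsPrimitiveRoot z n) (u : Circle)
    (i j : Fin n) :
    ∑ k : Fin n, starRingEnd ℂ (((u * z ^ (k : ℕ)) ^ (-(i : ℤ)) : Circle) : ℂ) *
      (((u * z ^ (k : ℕ)) ^ (-(j : ℤ)) : Circle) : ℂ) = if i = j then (n : ℂ) else 0 := by
  have hgeom : ∀ k : ℕ, starRingEnd ℂ (((u * z ^ k) ^ (-(i : ℤ)) : Circle) : ℂ) *
      (((u * z ^ k) ^ (-(j : ℤ)) : Circle) : ℂ) =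
      ((u ^ (i - j : ℤ) : Circle) : ℂ) * ((z ^ (i - j : ℤ) : Circle) : ℂ) ^ k := fun k => by
    rw [← Circle.coe_inv_eq_conj, ← Circle.coe_mul, ← Circle.coe_pow, ← Circle.coe_mul, zpow_neg,
      inv_inv, ← zpow_add, ← sub_eq_add_neg, mul_zpow, ← zpow_natCast, ← zpow_natCast, ← zpow_mul,
      ← zpow_mul, mul_comm (k : ℤ)]
  simp only [hgeom]
  rw [Fin.sum_univ_eq_sum_range (fun k => ((u ^ (i - j : ℤ) : Circle) : ℂ) *
    ((z ^ (i - j : ℤ) : Circle) : ℂ) ^ k), ← Finset.mul_sum]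
  split_ifs with hij
  · simp [hij]
  · have hne : z ^ (i - j : ℤ) ≠ 1 := fun h => by
      rw [zpow_sub, zpow_natCast, zpow_natCast, mul_inv_eq_one] at h
      exact hij (Fin.ext (hz.pow_inj i.isLt j.isLt h))
    have hpow : (z ^ (i - j : ℤ)) ^ n = 1 := by
      rw [← zpow_natCast, ← zpow_mul, mul_comm, zpow_mul, zpow_natCast, hz.pow_eq_one, one_zpow]
    rw [geom_sum_eq (Circle.coe_eq_one.not.2 hne), ← Circle.coe_pow, hpow, Circle.coe_one,
      sub_self, zero_div, mul_zero]

theorem sum_add_one_of_periodic {M : Type*} [AddCommGroup M] {g : ℤ → M} {n : ℕ}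
    (hg : Function.Periodic g n) : ∑ i : Fin n, g ((i : ℕ) + 1) = ∑ i : Fin n, g (i : ℕ) := by
  rw [Fin.sum_univ_eq_sum_range (fun i => g ((i : ℤ) + 1)) n,
    Fin.sum_univ_eq_sum_range (fun i => g (i : ℤ)) n, ← sub_eq_zero, ← Finset.sum_sub_distrib]
  have hsum := Finset.sum_range_sub (fun i : ℕ => g i) n
  push_cast at hsum
  rw [hsum, sub_eq_zero, ← hg 0, zero_add]

variable {X : Type*} [NormedAddCommGroup X] [NormedSpace ℂ X]

/-- The discrete Fourier coefficient at `w` of a window of length `n` of the sequence `f`; for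
`n`-periodic `f`, evaluated at the `n`-th roots of unity, this is the discrete Fourier transform. -/
noncomputable def fourierCoeff (n : ℕ) (w : Circle) (f : ℤ → X) : X :=
  ∑ i : Fin n, w ^ (-(i : ℤ)) • f (i : ℕ)

theorem fourierCoeff_laurentApply (A : BiSeq X →L[ℂ] BiSeq X) {n : ℕ} {t w : Circle}
    (hw : w ^ n = t⁻¹) {f : ℤ → X} (hf : IsTwistedPeriodic n t f) :
    fourierCoeff n w (laurentApply A f) = symbol A w (fourierCoeff n w f) := by
  set g : ℤ → X := fun i => w ^ (-i) • f i with hg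
  have hgn : Function.Periodic g n := fun i => by
    simp only [hg, hf i, ← hw, smul_smul, ← zpow_natCast, ← zpow_add]
    congr 2
    ring
  have hterm : ∀ i : ℤ, w ^ (-i) • laurentApply A f i =
      entry A 0 0 (g i) + w⁻¹ • entry A 1 0 (g (i - 1)) + w • entry A (-1) 0 (g (i + 1)) :=
    fun i => by
      simp only [laurentApply, hg, smul_add, Circle.smul_def, map_smul]
      simp only [← Circle.smul_def, smul_smul, ← zpow_neg_one w, ← zpow_add]
      rw [← zpow_one_add]
      congr 4 <;> ring_nf
  have hpred : ∑ i : Fin n, g ((i : ℕ) - 1) = ∑ i : Fin n, g (i : ℕ) := by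
    have := sum_add_one_of_periodic (g := fun i => g (i - 1)) (n := n) fun i => by
      simpa only [add_sub_right_comm] using hgn (i - 1)
    simpa only [add_sub_cancel_right] using this.symm
  simp only [fourierCoeff, hterm, Finset.sum_add_distrib, ← Finset.smul_sum, ← map_sum, hpred,
    sum_add_one_of_periodic hgn]
  rfl

end Fourier

section Parseval

variable {X : Type*} [NormedAddCommGroup X] [InnerProductSpace ℂ X]

theorem sum_norm_sum_smul_sq {K I : Type*} [Fintype K] [Fintype I] [DecidableEq I] {c : K → I → ℂ}
    {r : ℝ}
    (hc : ∀ i j, ∑ k, starRingEnd ℂ (c k i) * c k j = if i = j then (r : ℂ) else 0) (x : I → X) :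
    ∑ k, ‖∑ i, c k i • x i‖ ^ 2 = r * ∑ i, ‖x i‖ ^ 2 := by
  have sq : ∀ y : X, ((‖y‖ : ℝ) : ℂ) ^ 2 = inner ℂ y y := fun y =>
    (inner_self_eq_norm_sq_to_K (𝕜 := ℂ) y).symm
  have h : ((∑ k, ‖∑ i, c k i • x i‖ ^ 2 : ℝ) : ℂ) = ((r * ∑ i, ‖x i‖ ^ 2 : ℝ) : ℂ) := by
    push_cast
    simp only [sq, sum_inner, inner_sum, inner_smul_left, inner_smul_right, Finset.mul_sum]
    rw [Finset.sum_comm]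
    calc ∑ i, ∑ k, ∑ j, c k i * (starRingEnd ℂ (c k j) * inner ℂ (x j) (x i))
        = ∑ i, ∑ j, (∑ k, starRingEnd ℂ (c k j) * c k i) * inner ℂ (x j) (x i) := by
          refine Finset.sum_congr rfl fun i _ => ?_
          rw [Finset.sum_comm]
          refine Finset.sum_congr rfl fun j _ => ?_
          rw [Finset.sum_mul]
          exact Finset.sum_congr rfl fun k _ => by ring
      _ = ∑ i, (r : ℂ) * inner ℂ (x i) (x i) := by
          simp [hc, ite_mul]
  exact_mod_cast h

theorem exists_sum_norm_fourierCoeff_sq {n : ℕ} (hn : 1 ≤ n) (t : Circle) :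
    ∃ W : Fin n → Circle, (∀ k, W k ^ n = t) ∧ ∀ f : ℤ → X,
      ∑ k, ‖fourierCoeff n (W k) f‖ ^ 2 = n * ∑ i : Fin n, ‖f (i : ℕ)‖ ^ 2 := by
  obtain ⟨u, hu⟩ := exists_circle_pow_eq hn t
  obtain ⟨z, hz⟩ := exists_circle_isPrimitiveRoot hn
  refine ⟨fun k => u * z ^ (k : ℕ), fun k => ?_, fun f => ?_⟩
  · rw [mul_pow, hu, pow_right_comm, hz.pow_eq_one, one_pow, mul_one]
  · exact sum_norm_sum_smul_sq (fun i j => sum_conj_zpow_mul_zpow hz u i j) _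

theorem sq_mul_sum_le_sum_norm_laurentApply {A : BiSeq X →L[ℂ] BiSeq X} {n : ℕ} {t : Circle}
    {ε : ℝ} (hε : 0 ≤ ε) (hA : ∀ w, w ^ n = t⁻¹ → BoundedBelow ε (symbol A w)) {f : ℤ → X}
    (hf : IsTwistedPeriodic n t f) :
    ε ^ 2 * ∑ i : Fin n, ‖f (i : ℕ)‖ ^ 2 ≤ ∑ i : Fin n, ‖laurentApply A f (i : ℕ)‖ ^ 2 := by
  rcases n.eq_zero_or_pos with rfl | hn
  · simp
  obtain ⟨W, hW, hparseval⟩ := exists_sum_norm_fourierCoeff_sq (X := X) hn t⁻¹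
  refine le_of_mul_le_mul_left ?_ (show (0 : ℝ) < n by exact_mod_cast hn)
  rw [mul_left_comm, ← hparseval, ← hparseval, Finset.mul_sum]
  refine Finset.sum_le_sum fun k _ => ?_
  rw [fourierCoeff_laurentApply A (hW k) hf, ← mul_pow]
  exact pow_le_pow_left₀ (by positivity) (hA _ (hW k) _) 2

theorem boundedBelow_matOp_perSection_iff {A : BiSeq X →L[ℂ] BiSeq X} (hA : IsTridiagonal A)
    (hL : IsBlockLaurent A) {n : ℕ} (hn : 1 ≤ n) (t : Circle) {ε : ℝ} (hε : 0 ≤ ε) :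
    BoundedBelow ε (matOp (perSection A n 0 t)) ↔
      ∀ w, w ^ n = t⁻¹ → BoundedBelow ε (symbol A w) := by
  constructor
  · intro h w hw v
    have hnorm : ∀ u : X, ‖WithLp.toLp 2 fun i : Fin n => w ^ ((i : ℕ) : ℤ) • u‖ = √n * ‖u‖ :=
      fun u => by
        simp [PiLp.norm_eq_of_L2, Circle.norm_smul]
    have hwave := h (WithLp.toLp 2 fun i : Fin n => w ^ ((i : ℕ) : ℤ) • v)
    rw [matOp_perSection_apply hA hL (isTwistedPeriodic_wave hw v)] at hwave
    simp only [laurentApply_wave, hnorm] at hwave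
    rw [mul_left_comm] at hwave
    exact le_of_mul_le_mul_left hwave (by positivity)
  · intro h x
    obtain ⟨f, hf, hfx⟩ := exists_isTwistedPeriodic t hn x
    obtain rfl : x = WithLp.toLp 2 fun i : Fin n => f (i : ℕ) := by
      ext i
      exact (hfx i).symm
    rw [matOp_perSection_apply hA hL hf]
    refine le_of_sq_le_sq ?_ (norm_nonneg _)
    rw [mul_pow, PiLp.norm_sq_eq_of_L2, PiLp.norm_sq_eq_of_L2]
    exact sq_mul_sum_le_sum_norm_laurentApply hε h hf

end Parseval

section Waves

variable {X : Type*} [NormedAddCommGroup X]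

theorem BiSeq.norm_sq_eq_tsum (x : BiSeq X) : ‖x‖ ^ 2 = ∑' i, ‖x i‖ ^ 2 := by
  simpa using lp.norm_rpow_eq_tsum (p := 2) (by norm_num) x

theorem BiSeq.sum_norm_sq_le (x : BiSeq X) (s : Finset ℤ) : ∑ i ∈ s, ‖x i‖ ^ 2 ≤ ‖x‖ ^ 2 := by
  simpa using lp.sum_rpow_le_norm_rpow (p := 2) (by norm_num) x s

theorem BiSeq.norm_sum_single_sq (f : ℤ → X) (s : Finset ℤ) :
    ‖∑ i ∈ s, (lp.single 2 i (f i) : BiSeq X)‖ ^ 2 = ∑ i ∈ s, ‖f i‖ ^ 2 := by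
  simpa using lp.norm_sum_single (E := fun _ : ℤ => X) (p := 2) (by norm_num) f s

variable [NormedSpace ℂ X]

/-- The wave `j ↦ w ^ j • v` cut off to `0 ≤ j < N`: an approximate eigenvector of a block Laurent
operator, with the symbol in the role of the eigenvalue. -/
noncomputable def truncatedWave (w : Circle) (N : ℕ) (v : X) : BiSeq X :=
  ∑ j ∈ Finset.range N, lp.single 2 (j : ℤ) (w ^ j • v)

theorem norm_truncatedWave (w : Circle) (N : ℕ) (v : X) : ‖truncatedWave w N v‖ = √N * ‖v‖ := by
  have hsq := BiSeq.norm_sum_single_sq (fun j => w ^ j • v)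
    ((Finset.range N).map Nat.castEmbedding)
  simp only [Finset.sum_map, Nat.castEmbedding_apply, zpow_natCast, Circle.norm_smul,
    Finset.sum_const, Finset.card_map, Finset.card_range, nsmul_eq_mul] at hsq
  rw [truncatedWave, ← Real.sqrt_sq (norm_nonneg (∑ _ ∈ _, _)), hsq,
    Real.sqrt_mul (Nat.cast_nonneg N), Real.sqrt_sq (norm_nonneg v)]

theorem IsTridiagonal.apply_single {A : BiSeq X →L[ℂ] BiSeq X} (hA : IsTridiagonal A)
    (hL : IsBlockLaurent A) (j : ℤ) (v : X) :
    A (lp.single 2 j v) = (lp.single 2 j (entry A 0 0 v) : BiSeq X) +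
      lp.single 2 (j + 1) (entry A 1 0 v) + lp.single 2 (j - 1) (entry A (-1) 0 v) := by
  ext i
  rw [hA.apply_apply hL]
  simp only [laurentApply, lp.coeFn_add, Pi.add_apply, lp.coeFn_single, Pi.single_apply,
    sub_eq_iff_eq_add, ← eq_sub_iff_add_eq, apply_ite (entry A _ _), map_zero]

theorem apply_truncatedWave_sub {A : BiSeq X →L[ℂ] BiSeq X} (hA : IsTridiagonal A)
    (hL : IsBlockLaurent A) (w : Circle) (N : ℕ) (v : X) :
    A (truncatedWave w N v) - truncatedWave w N (symbol A w v) =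
    lp.single 2 (N : ℤ) (w ^ ((N : ℤ) - 1) • entry A 1 0 v)
      - lp.single 2 (0 : ℤ) (w ^ (-1 : ℤ) • entry A 1 0 v)
      + lp.single 2 (-1 : ℤ) (entry A (-1) 0 v)
      - lp.single 2 ((N : ℤ) - 1) (w ^ N • entry A (-1) 0 v) := by
  induction N with
  | zero => simp [truncatedWave]
  | succ N ih =>
    have hsub : w ^ N • w⁻¹ • entry A 1 0 v = w ^ ((N : ℤ) - 1) • entry A 1 0 v := by
      rw [smul_smul, zpow_sub_one, zpow_natCast]
    have hsup : w ^ N • w • entry A (-1) 0 v = w ^ (N + 1) • entry A (-1) 0 v := by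
      rw [smul_smul, pow_succ]
    have hmap : ∀ (B : X →L[ℂ] X) (u : Circle), B (u • v) = u • B v := fun B u => by
      simp only [Circle.smul_def, map_smul]
    have hsymbol : symbol A w v = entry A 0 0 v + w⁻¹ • entry A 1 0 v + w • entry A (-1) 0 v :=
      rfl
    have hstep : ∀ u : X, truncatedWave w (N + 1) u =
        truncatedWave w N u + lp.single 2 (N : ℤ) (w ^ N • u) := fun u => Finset.sum_range_succ ..
    rw [hstep, hstep, map_add, add_sub_add_comm, ih, hA.apply_single hL]
    simp only [hmap, hsymbol, smul_add, hsub, hsup, lp.single_add]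
    push_cast
    rw [add_sub_cancel_right, zpow_natCast]
    abel

theorem norm_apply_truncatedWave_sub_le {A : BiSeq X →L[ℂ] BiSeq X} (hA : IsTridiagonal A)
    (hL : IsBlockLaurent A) (w : Circle) (N : ℕ) (v : X) :
    ‖A (truncatedWave w N v) - truncatedWave w N (symbol A w v)‖ ≤
      2 * (‖entry A 1 0 v‖ + ‖entry A (-1) 0 v‖) := by
  have hsingle : ∀ (j : ℤ) (u : X), ‖(lp.single 2 j u : BiSeq X)‖ = ‖u‖ := fun j u =>
    lp.norm_single (E := fun _ : ℤ => X) (by norm_num) j u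
  rw [apply_truncatedWave_sub hA hL]
  calc _ ≤ ‖entry A 1 0 v‖ + ‖entry A 1 0 v‖ + ‖entry A (-1) 0 v‖ + ‖entry A (-1) 0 v‖ := by
        refine norm_sub_le_of_le (norm_add_le_of_le (norm_sub_le_of_le ?_ ?_) ?_) ?_ <;>
          simp only [hsingle, Circle.norm_smul, le_refl]
    _ = 2 * (‖entry A 1 0 v‖ + ‖entry A (-1) 0 v‖) := by ring

theorem BoundedBelow.boundedBelow_symbol {A : BiSeq X →L[ℂ] BiSeq X} {ε : ℝ} (h : BoundedBelow ε A)
    (hA : IsTridiagonal A) (hL : IsBlockLaurent A) (w : Circle) :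
    BoundedBelow ε (symbol A w) := fun v => by
  set C := 2 * (‖entry A 1 0 v‖ + ‖entry A (-1) 0 v‖)
  have hN : ∀ N : ℕ, √N * (ε * ‖v‖ - ‖symbol A w v‖) ≤ C := fun N => by
    have hwave := h (truncatedWave w N v)
    have htail := (norm_sub_norm_le _ _).trans (norm_apply_truncatedWave_sub_le hA hL w N v)
    rw [norm_truncatedWave] at hwave htail
    linarith
  by_contra! hlt
  have hlim : Tendsto (fun N : ℕ => √N * (ε * ‖v‖ - ‖symbol A w v‖)) atTop atTop :=
    (Real.tendsto_sqrt_atTop.comp tendsto_natCast_atTop_atTop).atTop_mul_const (by linarith)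
  obtain ⟨N, hCN⟩ := (hlim.eventually_gt_atTop C).exists
  exact (hN N).not_gt hCN

theorem exists_periodic_eq_of_support_subset {x : ℤ → X} {m : ℕ}
    (hx : ∀ i : ℤ, (m : ℤ) < |i| → x i = 0) :
    ∃ f : ℤ → X, IsTwistedPeriodic (2 * m + 3) 1 f ∧
      ∀ i : ℤ, -1 ≤ i → i ≤ 2 * m + 3 → f i = x (i - (m + 1)) := by
  obtain ⟨f, hf, hfx⟩ := exists_isTwistedPeriodic (n := 2 * m + 3) 1 (by omega)
    fun i => x ((i : ℕ) - (m + 1))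
  have hwindow : ∀ i : ℤ, 0 ≤ i → i < 2 * m + 3 → f i = x (i - (m + 1)) := fun i h0 hi => by
    simpa [h0] using hfx ⟨i.toNat, by omega⟩
  have hperiodic : ∀ i, f (i + (2 * m + 3)) = f i := fun i => by simpa using hf i
  refine ⟨f, hf, fun i h1 h2 => ?_⟩
  rcases h1.eq_or_lt with rfl | h1
  · rw [← hperiodic, hwindow _ (by omega) (by omega), hx _ (by rw [lt_abs]; omega),
      hx _ (by rw [lt_abs]; omega)]
  rcases h2.eq_or_lt with rfl | h2
  · rw [← zero_add (2 * (m : ℤ) + 3), hperiodic, hwindow 0 (by omega) (by omega),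
      hx _ (by rw [lt_abs]; omega), hx _ (by rw [lt_abs]; omega)]
  · exact hwindow i (by omega) h2

end Waves

section LaurentInner

variable {X : Type*} [NormedAddCommGroup X] [InnerProductSpace ℂ X]

theorem mul_norm_le_of_support_subset {A : BiSeq X →L[ℂ] BiSeq X} (hA : IsTridiagonal A)
    (hL : IsBlockLaurent A) {ε : ℝ} (hε : 0 ≤ ε) (h : ∀ w, BoundedBelow ε (symbol A w))
    {x : BiSeq X} {m : ℕ} (hx : ∀ i : ℤ, (m : ℤ) < |i| → x i = 0) : ε * ‖x‖ ≤ ‖A x‖ := by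
  obtain ⟨f, hf, hfx⟩ := exists_periodic_eq_of_support_subset hx
  let e : Fin (2 * m + 3) ↪ ℤ :=
    ⟨fun i => i - (m + 1), fun i j hij => Fin.ext (by simpa using hij)⟩
  have he : ∀ i, e i = i - (m + 1) := fun _ => rfl
  have hnorm : ∑ i : Fin (2 * m + 3), ‖f (i : ℕ)‖ ^ 2 = ‖x‖ ^ 2 := by
    rw [BiSeq.norm_sq_eq_tsum, ← e.injective.tsum_eq, tsum_fintype]
    · exact Finset.sum_congr rfl fun i _ => by rw [hfx _ (by omega) (by omega), he]
    · intro i hi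
      have him : |i| ≤ m := not_lt.1 fun hlt => hi (by simp [hx i hlt])
      rw [abs_le] at him
      exact ⟨⟨(i + (m + 1)).toNat, by omega⟩, by
        rw [he, Fin.val_mk, Int.toNat_of_nonneg (by omega), add_sub_cancel_right]⟩
  have happly : ∀ i : Fin (2 * m + 3), laurentApply A f (i : ℕ) = A x (e i) := fun i => by
    rw [hA.apply_apply hL, laurentApply, laurentApply, hfx _ (by omega) (by omega),
      hfx _ (by omega) (by omega), hfx _ (by omega) (by omega), he, sub_right_comm _ (1 : ℤ),
      sub_add_eq_add_sub]
  have hsum := sq_mul_sum_le_sum_norm_laurentApply hε (fun w _ => h w) hf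
  simp only [happly, hnorm] at hsum
  refine le_of_sq_le_sq ?_ (norm_nonneg _)
  rw [mul_pow]
  refine hsum.trans ?_
  simpa using BiSeq.sum_norm_sq_le (A x) (Finset.univ.map e)

theorem boundedBelow_iff_symbol {A : BiSeq X →L[ℂ] BiSeq X} (hA : IsTridiagonal A)
    (hL : IsBlockLaurent A) {ε : ℝ} (hε : 0 ≤ ε) :
    BoundedBelow ε A ↔ ∀ w, BoundedBelow ε (symbol A w) := by
  refine ⟨fun h => h.boundedBelow_symbol hA hL, fun h x => ?_⟩
  have hlim := lp.hasSum_single (E := fun _ : ℤ => X) (p := 2) (by norm_num) x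
  refine le_of_tendsto_of_tendsto' (hlim.norm.const_mul ε)
    ((A.continuous.tendsto _).comp hlim).norm fun F => ?_
  refine mul_norm_le_of_support_subset hA hL hε h (m := F.sup Int.natAbs) fun i hi => ?_
  rw [lp.coeFn_sum, Finset.sum_apply]
  refine Finset.sum_eq_zero fun j hj => lp.single_apply_ne _ _ _ ?_
  rintro rfl
  have := Finset.le_sup (f := Int.natAbs) hj
  rw [Int.abs_eq_natAbs] at hi
  omega

end LaurentInner

section Symbol

variable {X : Type*} [NormedAddCommGroup X] [NormedSpace ℂ X]

theorem continuous_symbol (A : BiSeq X →L[ℂ] BiSeq X) : Continuous (symbol A) := by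
  unfold symbol
  fun_prop

theorem norm_symbol_sub_le (A : BiSeq X →L[ℂ] BiSeq X) (w u : Circle) :
    ‖symbol A w - symbol A u‖ ≤
      (‖entry A 1 0‖ + ‖entry A (-1) 0‖) * ‖(w : ℂ) - (u : ℂ)‖ := by
  have hsub : symbol A w - symbol A u =
      starRingEnd ℂ ((w : ℂ) - u) • entry A 1 0 + ((w : ℂ) - u) • entry A (-1) 0 := by
    simp only [symbol, Circle.smul_def, Circle.coe_inv_eq_conj, map_sub]
    module
  rw [hsub, add_mul]
  refine norm_add_le_of_le ?_ ?_
  · rw [norm_smul, RCLike.norm_conj, mul_comm]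
  · rw [norm_smul, mul_comm]

theorem exists_circle_pow_eq_near {n : ℕ} (hn : 1 ≤ n) (t u : Circle) :
    ∃ w : Circle, w ^ n = t ∧ ‖(w : ℂ) - u‖ ≤ 2 * Real.sin (Real.pi / (2 * n)) := by
  have hn0 : (0 : ℝ) < n := by positivity
  have hn1 : (1 : ℝ) ≤ n := by exact_mod_cast hn
  set θ := Complex.arg ((t / u ^ n : Circle) : ℂ) with hθ
  refine ⟨u * Circle.exp (θ / n), ?_, ?_⟩
  · rw [mul_pow, ← Circle.exp_nsmul, nsmul_eq_mul, mul_div_cancel₀ _ hn0.ne', hθ, Circle.exp_arg,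
      mul_div_cancel]
  · have hchord : ((u * Circle.exp (θ / n) : Circle) : ℂ) - u =
        u * (Complex.exp (Complex.I * (θ / n : ℝ)) - 1) := by
      rw [Circle.coe_mul, Circle.coe_exp, mul_comm Complex.I]
      ring
    have hangle : |θ / n / 2| ≤ Real.pi / (2 * n) := by
      rw [div_div, abs_div, abs_of_pos (by positivity : (0 : ℝ) < n * 2), mul_comm (n : ℝ)]
      gcongr
      exact Complex.abs_arg_le_pi _
    have hquarter : Real.pi / (2 * n) ≤ Real.pi / 2 := by
      gcongr
      linarith
    obtain ⟨hlower, hupper⟩ := abs_le.1 hangle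
    rw [hchord, norm_mul, Circle.norm_coe, one_mul, Complex.norm_exp_I_mul_ofReal_sub_one, norm_mul,
      Real.norm_ofNat, Real.norm_eq_abs]
    gcongr
    rw [abs_le, ← Real.sin_neg]
    exact ⟨Real.sin_le_sin_of_le_of_le_pi_div_two (by linarith) (by linarith) hlower,
      Real.sin_le_sin_of_le_of_le_pi_div_two (by linarith) (by linarith) hupper⟩

theorem IsBlockLaurent.penalty_eq {A : BiSeq X →L[ℂ] BiSeq X} (hL : IsBlockLaurent A) (n : ℕ) :
    penalty A n =
      (‖entry A 1 0‖ + ‖entry A (-1) 0‖) * (2 * Real.sin (Real.pi / (2 * n))) := by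
  have hα : ∀ j, ‖subdiag A j‖ = ‖entry A 1 0‖ := fun j => by
    rw [subdiag, hL.entry_eq, add_sub_cancel_left]
  have hγ : ∀ j, ‖superdiag A j‖ = ‖entry A (-1) 0‖ := fun j => by
    rw [superdiag, hL.entry_eq, sub_sub_cancel_left]
  simp only [penalty, hα, hγ, ciSup_const]
  ring

theorem exists_norm_symbol_sub_le_penalty {A : BiSeq X →L[ℂ] BiSeq X} (hL : IsBlockLaurent A)
    {n : ℕ} (hn : 1 ≤ n) (t u : Circle) :
    ∃ w : Circle, w ^ n = t ∧ ‖symbol A w - symbol A u‖ ≤ penalty A n := by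
  obtain ⟨w, hw, hwu⟩ := exists_circle_pow_eq_near hn t u
  refine ⟨w, hw, (norm_symbol_sub_le A w u).trans ?_⟩
  rw [hL.penalty_eq]
  gcongr

theorem penalty_nonneg (A : BiSeq X →L[ℂ] BiSeq X) (n : ℕ) : 0 ≤ penalty A n := by
  have hα : 0 ≤ ⨆ j : ℤ, ‖subdiag A j‖ := Real.iSup_nonneg fun _ => norm_nonneg _
  have hγ : 0 ≤ ⨆ j : ℤ, ‖superdiag A j‖ := Real.iSup_nonneg fun _ => norm_nonneg _
  have hsin : 0 ≤ Real.sin (Real.pi / (2 * n)) := by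
    refine Real.sin_nonneg_of_nonneg_of_le_pi (by positivity) ?_
    rcases Nat.eq_zero_or_pos n with rfl | hn
    · simpa using Real.pi_pos.le
    · have : (1 : ℝ) ≤ n := by exact_mod_cast hn
      exact div_le_self Real.pi_pos.le (by linarith)
  rw [penalty]
  positivity

theorem tendsto_penalty (A : BiSeq X →L[ℂ] BiSeq X) : Tendsto (penalty A) atTop (𝓝 0) := by
  have hangle : Tendsto (fun n : ℕ => Real.pi / (2 * (n : ℝ))) atTop (𝓝 0) :=
    tendsto_const_nhds.div_atTop
      (tendsto_natCast_atTop_atTop.const_mul_atTop (by norm_num : (0 : ℝ) < 2))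
  have hlim := ((Real.continuous_sin.tendsto 0).comp hangle).const_mul
    (2 * ((⨆ j : ℤ, ‖subdiag A j‖) + ⨆ j : ℤ, ‖superdiag A j‖))
  rwa [Real.sin_zero, mul_zero] at hlim

theorem IsBlockLaurent.piOpen_eq {A : BiSeq X →L[ℂ] BiSeq X} (hL : IsBlockLaurent A) (n : ℕ)
    (t : Circle) (ε : ℝ) : piOpen n t ε A = specn ε (matOp (perSection A n 0 t)) := by
  simp only [piOpen, hL.perSection_eq _ n t, Set.iUnion_const]

theorem IsBlockLaurent.piClosed_eq [CompleteSpace X] {A : BiSeq X →L[ℂ] BiSeq X}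
    (hL : IsBlockLaurent A) (n : ℕ) (t : Circle) (ε : ℝ) :
    piClosed n t ε A = Specn ε (matOp (perSection A n 0 t)) := by
  simp only [piClosed, hL.perSection_eq _ n t, Set.iUnion_const]
  exact (isClosed_Specn ε _).closure_eq

end Symbol

section Pseudospectra

variable {X : Type*} [NormedAddCommGroup X] [InnerProductSpace ℂ X] [CompleteSpace X]
  {A : BiSeq X →L[ℂ] BiSeq X} {n : ℕ} {ε : ℝ}

theorem specn_eq_iUnion_symbol (hA : IsTridiagonal A) (hL : IsBlockLaurent A) (hε : 0 < ε) :
    specn ε A = ⋃ w, specn ε (symbol A w) := by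
  ext l
  rw [← not_iff_not, Set.mem_iUnion, not_exists, notMem_specn_iff_boundedBelow hε,
    boundedBelow_iff_symbol (hA.sub_smul_id l) (hL.sub_smul_id l) hε.le,
    boundedBelow_iff_symbol (hA.sub_smul_id l).adjoint (hL.sub_smul_id l).adjoint hε.le]
  simp only [symbol_adjoint (hL.sub_smul_id l), symbol_sub_smul_id, ← forall_and,
    notMem_specn_iff_boundedBelow hε]

theorem specn_matOp_perSection_eq_iUnion_symbol (hA : IsTridiagonal A) (hL : IsBlockLaurent A)
    (hn : 1 ≤ n) (t : Circle) (hε : 0 < ε) :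
    specn ε (matOp (perSection A n 0 t)) =
      ⋃ (w : Circle) (_ : w ^ n = t⁻¹), specn ε (symbol A w) := by
  ext l
  have hA' := hA.sub_smul_id l
  have hL' := hL.sub_smul_id l
  rw [← not_iff_not, notMem_specn_iff_boundedBelow hε, ← matOp_perSection_sub_smul_id,
    ← matOp_adjoint (perSection_adjoint hL' n t),
    boundedBelow_matOp_perSection_iff hA' hL' hn t hε.le,
    boundedBelow_matOp_perSection_iff hA'.adjoint hL'.adjoint hn t hε.le]
  simp only [symbol_adjoint hL', symbol_sub_smul_id, ← forall_and, Set.mem_iUnion, not_exists,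
    notMem_specn_iff_boundedBelow hε]

theorem specn_perSection_subset (hA : IsTridiagonal A) (hL : IsBlockLaurent A) (hn : 1 ≤ n)
    (t : Circle) (hε : 0 < ε) : specn ε (matOp (perSection A n 0 t)) ⊆ specn ε A := by
  rw [specn_eq_iUnion_symbol hA hL hε, specn_matOp_perSection_eq_iUnion_symbol hA hL hn t hε]
  exact Set.iUnion_mono fun w => Set.iUnion_subset fun _ => subset_rfl

theorem specn_symbol_subset_specn_perSection (hA : IsTridiagonal A) (hL : IsBlockLaurent A)
    (hn : 1 ≤ n) (w : Circle) (hε : 0 < ε) :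
    specn ε (symbol A w) ⊆ specn ε (matOp (perSection A n 0 (w ^ n)⁻¹)) := by
  rw [specn_matOp_perSection_eq_iUnion_symbol hA hL hn _ hε]
  exact Set.subset_iUnion₂_of_subset w (inv_inv _).symm subset_rfl

theorem specn_subset_specn_perSection (hA : IsTridiagonal A) (hL : IsBlockLaurent A) (hn : 1 ≤ n)
    (t : Circle) (hε : 0 < ε) :
    specn ε A ⊆ specn (ε + penalty A n) (matOp (perSection A n 0 t)) := by
  rw [specn_eq_iUnion_symbol hA hL hε, specn_matOp_perSection_eq_iUnion_symbol hA hL hn t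
    (add_pos_of_pos_of_nonneg hε (penalty_nonneg A n))]
  refine Set.iUnion_subset fun u => ?_
  obtain ⟨w, hw, hwu⟩ := exists_norm_symbol_sub_le_penalty hL hn t⁻¹ u
  exact Set.subset_iUnion₂_of_subset w hw (specn_subset_specn_add hε.le hwu)

theorem Specn_perSection_subset (hA : IsTridiagonal A) (hL : IsBlockLaurent A) (hn : 1 ≤ n)
    (t : Circle) (hε : 0 ≤ ε) : Specn ε (matOp (perSection A n 0 t)) ⊆ Specn ε A :=
  Specn_subset_Specn_of_specn hε hε fun _ hr =>
    specn_perSection_subset hA hL hn t (add_pos_of_nonneg_of_pos hε hr)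

theorem Specn_subset_Specn_perSection (hA : IsTridiagonal A) (hL : IsBlockLaurent A) (hn : 1 ≤ n)
    (t : Circle) (hε : 0 ≤ ε) :
    Specn ε A ⊆ Specn (ε + penalty A n) (matOp (perSection A n 0 t)) :=
  Specn_subset_Specn_of_specn hε (add_nonneg hε (penalty_nonneg A n)) fun r hr => by
    rw [add_right_comm]
    exact specn_subset_specn_perSection hA hL hn t (add_pos_of_nonneg_of_pos hε hr)

theorem noSpectralPollution (hA : IsTridiagonal A) (hL : IsBlockLaurent A) (t : Circle) :
    NoSpectralPollution t A := by
  refine ⟨fun n => 1 / ((n : ℝ) + 1), fun n => by positivity,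
    tendsto_one_div_add_atTop_nhds_zero_nat, fun ε hε n hn k => ?_⟩
  rw [hL.perSection_eq]
  exact (specn_perSection_subset hA hL hn t hε).trans
    (specn_mono A (le_add_of_nonneg_right (by positivity)))

theorem specn_eq_iUnion_perSection (hA : IsTridiagonal A) (hL : IsBlockLaurent A) (hn : 1 ≤ n)
    (hε : 0 < ε) : specn ε A = ⋃ t, specn ε (matOp (perSection A n 0 t)) := by
  refine (Set.iUnion_subset fun t => specn_perSection_subset hA hL hn t hε).antisymm' ?_
  rw [specn_eq_iUnion_symbol hA hL hε]
  exact Set.iUnion_subset fun w => Set.subset_iUnion_of_subset (w ^ n)⁻¹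
    (specn_symbol_subset_specn_perSection hA hL hn w hε)

theorem Specn_eq_iUnion_perSection (hA : IsTridiagonal A) (hL : IsBlockLaurent A) (hn : 1 ≤ n)
    (hε : 0 ≤ ε) : Specn ε A = ⋃ t, Specn ε (matOp (perSection A n 0 t)) := by
  refine (Set.iUnion_subset fun t => Specn_perSection_subset hA hL hn t hε).antisymm' fun l hl => ?_
  obtain ⟨w, hw⟩ := exists_mem_Specn_of_forall_exists_mem_specn (continuous_symbol A) hε (l := l)
    fun δ hδ => by
      rw [← Set.mem_iUnion, ← specn_eq_iUnion_symbol hA hL (hε.trans_lt hδ)]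
      exact Specn_subset_specn A hε hδ hl
  exact Set.mem_iUnion.2 ⟨(w ^ n)⁻¹, Specn_subset_Specn_of_specn hε hε (fun _ hr =>
    specn_symbol_subset_specn_perSection hA hL hn w (add_pos_of_nonneg_of_pos hε hr)) hw⟩

theorem BiSeq.nontrivial (X : Type*) [NormedAddCommGroup X] [Nontrivial X] :
    Nontrivial (BiSeq X) := by
  obtain ⟨v, hv⟩ := exists_ne (0 : X)
  exact ⟨⟨lp.single 2 0 v, 0, fun h => hv (by simpa using congrArg (fun x : BiSeq X => x 0) h)⟩⟩

variable [Nontrivial X]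

theorem hausdorffTendsto_Specn (hA : IsTridiagonal A) (hL : IsBlockLaurent A) (t : Circle)
    (hε : 0 ≤ ε) :
    HausdorffTendsto (fun n => Specn (ε + penalty A n) (matOp (perSection A n 0 t)))
      (Specn ε A) :=
  have := BiSeq.nontrivial X
  hausdorffTendsto_of_subset_Specn A hε (tendsto_penalty A) (nonempty_Specn A hε) subset_rfl
    subset_closure (fun _ hn => Specn_subset_Specn_perSection hA hL hn t hε)
    (fun n hn => Specn_perSection_subset hA hL hn t (add_nonneg hε (penalty_nonneg A n)))

theorem hausdorffTendsto_specn (hA : IsTridiagonal A) (hL : IsBlockLaurent A) (t : Circle)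
    (hε : 0 < ε) :
    HausdorffTendsto (fun n => specn (ε + penalty A n) (matOp (perSection A n 0 t)))
      (specn ε A) :=
  have := BiSeq.nontrivial X
  hausdorffTendsto_of_subset_Specn A hε.le (tendsto_penalty A)
    ((nonempty_Specn A le_rfl).mono (Specn_subset_specn A le_rfl hε)) (specn_subset_Specn ε A)
    (Specn_subset_closure_specn A hε) (fun _ hn => specn_subset_specn_perSection hA hL hn t hε)
    (fun n hn => (specn_perSection_subset hA hL hn t
      (add_pos_of_pos_of_nonneg hε (penalty_nonneg A n))).trans (specn_subset_Specn _ A))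

end Pseudospectra

end PiMethod

theorem theorem8p1_general {X : Type*} [NormedAddCommGroup X] [InnerProductSpace ℂ X]
    [CompleteSpace X] [Nontrivial X] (A : BiSeq X →L[ℂ] BiSeq X)
    (hA : IsTridiagonal A) (hL : IsBlockLaurent A) :
    (∀ (k : ℤ) (n : ℕ), 1 ≤ n → ∀ t : Circle, perSection A n k t = perSection A n 0 t) ∧
    (∀ n : ℕ, 1 ≤ n → ∀ t : Circle,
      (∀ ε : ℝ, 0 ≤ ε → piClosed n t ε A = Specn ε (matOp (perSection A n 0 t))) ∧
      (∀ ε : ℝ, 0 < ε → piOpen n t ε A = specn ε (matOp (perSection A n 0 t)))) ∧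
    (∀ t : Circle, NoSpectralPollution t A) ∧
    (∀ n : ℕ, 1 ≤ n →
      spectrum ℂ A = ⋃ t : Circle, spectrum ℂ (matOp (perSection A n 0 t)) ∧
      ∀ ε : ℝ, 0 < ε →
        specn ε A = ⋃ t : Circle, specn ε (matOp (perSection A n 0 t)) ∧
        Specn ε A = ⋃ t : Circle, Specn ε (matOp (perSection A n 0 t))) ∧
    (∀ t : Circle,
      (∀ ε : ℝ, 0 ≤ ε →
        (∀ n : ℕ, 1 ≤ n → piClosed n t (ε + penalty A n) A =
          Specn (ε + penalty A n) (matOp (perSection A n 0 t))) ∧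
        HausdorffTendsto
          (fun n => Specn (ε + penalty A n) (matOp (perSection A n 0 t))) (Specn ε A)) ∧
      ((∀ n : ℕ, 1 ≤ n → piClosed n t (penalty A n) A =
          Specn (penalty A n) (matOp (perSection A n 0 t))) ∧
        HausdorffTendsto
          (fun n => Specn (penalty A n) (matOp (perSection A n 0 t))) (spectrum ℂ A)) ∧
      (∀ ε : ℝ, 0 < ε →
        (∀ n : ℕ, 1 ≤ n → piOpen n t (ε + penalty A n) A =
          specn (ε + penalty A n) (matOp (perSection A n 0 t))) ∧
        HausdorffTendsto
          (fun n => specn (ε + penalty A n) (matOp (perSection A n 0 t))) (specn ε A))) := by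
  refine ⟨fun k n _ t => hL.perSection_eq k n t,
    fun n _ t => ⟨fun ε _ => hL.piClosed_eq n t ε, fun ε _ => hL.piOpen_eq n t ε⟩,
    noSpectralPollution hA hL,
    fun n hn => ⟨?_, fun ε hε => ⟨specn_eq_iUnion_perSection hA hL hn hε,
      Specn_eq_iUnion_perSection hA hL hn hε.le⟩⟩,
    fun t => ⟨fun ε hε => ⟨fun n _ => hL.piClosed_eq n t _, hausdorffTendsto_Specn hA hL t hε⟩,
      ⟨fun n _ => hL.piClosed_eq n t _, ?_⟩,
      fun ε hε => ⟨fun n _ => hL.piOpen_eq n t _, hausdorffTendsto_specn hA hL t hε⟩⟩⟩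
  · simpa only [Specn_zero] using Specn_eq_iUnion_perSection hA hL hn le_rfl
  · simpa only [zero_add, Specn_zero] using hausdorffTendsto_Specn hA hL t le_rfl

theorem theorem8p1 (p : ℕ) (hp : 1 ≤ p)
    (A : BiSeq (EuclideanSpace ℂ (Fin p)) →L[ℂ] BiSeq (EuclideanSpace ℂ (Fin p)))
    (hA : IsTridiagonal A) (hL : IsBlockLaurent A) :
    -- the periodised sections coincide, and the sets of the method are those of one section
    (∀ (k : ℤ) (n : ℕ), 1 ≤ n → ∀ t : Circle, perSection A n k t = perSection A n 0 t) ∧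
    (∀ n : ℕ, 1 ≤ n → ∀ t : Circle,
      (∀ ε : ℝ, 0 ≤ ε → piClosed n t ε A = Specn ε (matOp (perSection A n 0 t))) ∧
      (∀ ε : ℝ, 0 < ε → piOpen n t ε A = specn ε (matOp (perSection A n 0 t)))) ∧
    -- absence of spectral pollution
    (∀ t : Circle, NoSpectralPollution t A) ∧
    -- the union formulae
    (∀ n : ℕ, 1 ≤ n →
      spectrum ℂ A = ⋃ t : Circle, spectrum ℂ (matOp (perSection A n 0 t)) ∧
      ∀ ε : ℝ, 0 < ε →
        specn ε A = ⋃ t : Circle, specn ε (matOp (perSection A n 0 t)) ∧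
        Specn ε A = ⋃ t : Circle, Specn ε (matOp (perSection A n 0 t))) ∧
    -- Hausdorff convergence
    (∀ t : Circle,
      (∀ ε : ℝ, 0 ≤ ε →
        (∀ n : ℕ, 1 ≤ n → piClosed n t (ε + penalty A n) A =
          Specn (ε + penalty A n) (matOp (perSection A n 0 t))) ∧
        HausdorffTendsto
          (fun n => Specn (ε + penalty A n) (matOp (perSection A n 0 t))) (Specn ε A)) ∧
      ((∀ n : ℕ, 1 ≤ n → piClosed n t (penalty A n) A =
          Specn (penalty A n) (matOp (perSection A n 0 t))) ∧
        HausdorffTendsto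
          (fun n => Specn (penalty A n) (matOp (perSection A n 0 t))) (spectrum ℂ A)) ∧
      (∀ ε : ℝ, 0 < ε →
        (∀ n : ℕ, 1 ≤ n → piOpen n t (ε + penalty A n) A =
          specn (ε + penalty A n) (matOp (perSection A n 0 t))) ∧
        HausdorffTendsto
          (fun n => specn (ε + penalty A n) (matOp (perSection A n 0 t))) (specn ε A))) := by
  have : Nontrivial (EuclideanSpace ℂ (Fin p)) :=
    Module.nontrivial_of_finrank_pos (R := ℂ) (by rw [finrank_euclideanSpace_fin]; omega)
  exact theorem8p1_general A hA hL
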